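/- Let $(M,g)$ be a nonempty smooth (Hausdorff, $C^\infty$, without boundary) Riemannian manifold of dimension $n\ge 1$ with Levi-Civita connection $\nabla$, Christoffel symbols $\Gamma^h_{ij}$ and curvature $R(X,Y)=[\nabla_X,\nabla_Y]-\nabla_{[X,Y]}$, and let $f\in C^\infty(M)$ with $f>0$. Let $T^*M$ be the cotangent bundle, with the local coordinates $(x^i,p_i)$ induced by local coordinates $(x^i)$ of $M$. For a covector field $\omega$ and a vector field $X$ on $M$ define the vertical and horizontal lifts $${}^V\omega=\omega_i\frac{\partial}{\partial p_i},\qquad {}^HX=X^i\frac{\partial}{\partial x^i}+p_h\Gamma^h_{ij}X^j\frac{\partial}{\partial p_i}.$$ Put $g^{-1}(\omega,\theta)=g^{ij}\omega_i\theta_j$ and $\alpha=1+g^{-1}(p,p)$, let ${}^{CG}g_f$ be the metric on $T^*M$ given by $${}^{CG}g_f({}^V\omega,{}^V\theta)=\tfrac1\alpha\bigl(g^{-1}(\omega,\theta)+g^{-1}(\omega,p)\,g^{-1}(\theta,p)\bigr),\quad {}^{CG}g_f({}^V\omega,{}^HY)=0,\quad {}^{CG}g_f({}^HX,{}^HY)=f\,g(X,Y),$$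 and let $J$ be the $(1,1)$-tensor field on $T^*M$ with $J({}^HX)=-{}^HX$ and $J({}^V\omega)={}^V\omega$. A triple $(N,F,G)$ is called a locally decomposable Riemannian manifold if $G$ is a smooth Riemannian metric on the manifold $N$ and $F\ne\pm\mathrm{id}$ is a smooth $(1,1)$-tensor field on $N$ with $F^2=\mathrm{id}$ and $G(FX,Y)=G(X,FY)$ for all vector fields $X,Y$, such that $F$ is parallel with respect to the Levi-Civita connection of $G$. Further, let $$(\Phi_FG)(X,Y,Z)=(FX)(G(Y,Z))-X(G(FY,Z))+G((L_YF)X,Z)+G(Y,(L_ZF)X),$$ where $L$ denotes the Lie derivative. Then each of the following three conditions holds if and only if $(M,g)$ is flat, i.e. $R=0$: 1. $(T^*M,J,{}^{CG}g_f)$ is a locally decomposable Riemannian manifold; 2. $J$ is parallel with respect to the Levi-Civita connection of ${}^{CG}g_f$; 3. $(\Phi_J\,{}^{CG}g_f)(X,Y,Z)=0$ for all smooth vector fields $X,Y,Z$ on $T^*M$. -/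

import Mathlib

open scoped Manifold ContDiff

set_option maxSynthPendingDepth 3

noncomputable section

section General

variable {E : Type*} [NormedAddCommGroup E] [NormedSpace ℝ E]
  {H : Type*} [TopologicalSpace H] (I : ModelWithCorners ℝ E H)
  {N : Type*} [TopologicalSpace N] [ChartedSpace H N] [IsManifold I ∞ N]

/-- The components `y ↦ (g_ij(y))`, in the chart around `x₀`, of a field `g` of bilinear forms on
the tangent spaces of `N`. Here `symmL ℝ x` is the linear isomorphism `E → T_x N` given by the
coordinate frame of the chart around `x₀`. -/
def bilinInChart (g : ∀ x : N, TangentSpace I x →L[ℝ] TangentSpace I x →L[ℝ] ℝ)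
    (x₀ : N) (y : E) : E →L[ℝ] E →L[ℝ] ℝ :=
  let x : N := (extChartAt I x₀).symm y
  let G : E →L[ℝ] E →L[ℝ] ℝ := g x
  let S : E →L[ℝ] E := (trivializationAt E (TangentSpace I) x₀).symmL ℝ x
  G.bilinearComp S S

/-- The components `y ↦ (F^i_j(y))`, in the chart around `x₀`, of a field `F` of endomorphisms of
the tangent spaces of `N`. -/
def endoInChart (F : ∀ x : N, TangentSpace I x →L[ℝ] TangentSpace I x)
    (x₀ : N) (y : E) : E →L[ℝ] E :=
  let x : N := (extChartAt I x₀).symm y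
  let A : E →L[ℝ] E := F x
  let S : E →L[ℝ] E := (trivializationAt E (TangentSpace I) x₀).symmL ℝ x
  let T : E →L[ℝ] E := (trivializationAt E (TangentSpace I) x₀).continuousLinearMapAt ℝ x
  T.comp (A.comp S)

/-- The trilinear map `(u, v, w) ↦ (∂_u g)(v, w) + (∂_v g)(u, w) - (∂_w g)(u, v)` in the chart
around `x₀`, at the point of that chart with coordinates `y`. -/
def koszulForm (g : ∀ x : N, TangentSpace I x →L[ℝ] TangentSpace I x →L[ℝ] ℝ)
    (x₀ : N) (y : E) : E →L[ℝ] E →L[ℝ] E →L[ℝ] ℝ :=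
  let D : E →L[ℝ] E →L[ℝ] E →L[ℝ] ℝ := fderiv ℝ (bilinInChart I g x₀) y
  let flip₂ : (E →L[ℝ] E →L[ℝ] ℝ) →L[ℝ] (E →L[ℝ] E →L[ℝ] ℝ) :=
    (ContinuousLinearMap.flipₗᵢ ℝ E E ℝ).toContinuousLinearEquiv.toContinuousLinearMap
  D + D.flip - flip₂.comp D.flip

/-- The Christoffel symbols `(u, v) ↦ Γ(u, v)`, `Γ^h_ij u^i v^j`, of the Levi-Civita connection of
the metric `g` in the chart around `x₀`, at the point with coordinates `y`:
`g(Γ(u, v), w) = ½ ((∂_u g)(v, w) + (∂_v g)(u, w) - (∂_w g)(u, v))`. -/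
def christoffel (g : ∀ x : N, TangentSpace I x →L[ℝ] TangentSpace I x →L[ℝ] ℝ)
    (x₀ : N) (y : E) : E →L[ℝ] E →L[ℝ] E :=
  (1 / 2 : ℝ) • (ContinuousLinearMap.compL ℝ E (E →L[ℝ] ℝ) E
    (bilinInChart I g x₀ y).inverse).comp (koszulForm I g x₀ y)

/-- The Riemannian curvature `R(u, v) w` at `x`, for `R(X, Y) = [∇_X, ∇_Y] - ∇_[X, Y]` and `∇` the
Levi-Civita connection of `g`, computed in the chart around `x` (the tangent space at `x` is
identified with `E` by that chart). -/
def riemannCurvature (g : ∀ x : N, TangentSpace I x →L[ℝ] TangentSpace I x →L[ℝ] ℝ)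
    (x : N) (u v w : TangentSpace I x) : TangentSpace I x :=
  let y : E := extChartAt I x x
  let Γ : E → E →L[ℝ] E →L[ℝ] E := christoffel I g x
  let u' : E := u
  let v' : E := v
  let w' : E := w
  fderiv ℝ Γ y u' v' w' - fderiv ℝ Γ y v' u' w' + Γ y u' (Γ y v' w') - Γ y v' (Γ y u' w')

/-- The metric `g` is flat: its Riemannian curvature tensor vanishes. -/
def IsFlatMetric (g : ∀ x : N, TangentSpace I x →L[ℝ] TangentSpace I x →L[ℝ] ℝ) : Prop :=
  ∀ (x : N) (u v w : TangentSpace I x), riemannCurvature I g x u v w = 0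

/-- The value `(∇_u F) v` at `x` of the covariant derivative of the endomorphism field `F` with
respect to the Levi-Civita connection of `g`, computed in the chart around `x`:
`(∇_u F) v = (∂_u F) v + Γ(u, F v) - F (Γ(u, v))`. -/
def covDerivEndo (g : ∀ x : N, TangentSpace I x →L[ℝ] TangentSpace I x →L[ℝ] ℝ)
    (F : ∀ x : N, TangentSpace I x →L[ℝ] TangentSpace I x)
    (x : N) (u v : TangentSpace I x) : TangentSpace I x :=
  let y : E := extChartAt I x x
  let Γ : E →L[ℝ] E →L[ℝ] E := christoffel I g x y
  let A : E → E →L[ℝ] E := endoInChart I F x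
  let u' : E := u
  let v' : E := v
  fderiv ℝ A y u' v' + Γ u' (A y v') - A y (Γ u' v')

/-- The endomorphism field `F` is covariantly constant with respect to the Levi-Civita connection
of `g`. -/
def IsParallelEndo (g : ∀ x : N, TangentSpace I x →L[ℝ] TangentSpace I x →L[ℝ] ℝ)
    (F : ∀ x : N, TangentSpace I x →L[ℝ] TangentSpace I x) : Prop :=
  ∀ (x : N) (u v : TangentSpace I x), covDerivEndo I g F x u v = 0

/-- `(N, F, g)` is an almost product Riemannian manifold: `g` is a smooth Riemannian metric and `F`
is a smooth non-trivial (different from `±id`) field of endomorphisms with `F² = id` and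
`g(F u, v) = g(u, F v)`. -/
structure IsAlmostProductRiemannian
    (g : ∀ x : N, TangentSpace I x →L[ℝ] TangentSpace I x →L[ℝ] ℝ)
    (F : ∀ x : N, TangentSpace I x →L[ℝ] TangentSpace I x) : Prop where
  metric : ∃ h : Bundle.ContMDiffRiemannianMetric I ∞ E (fun x : N ↦ TangentSpace I x),
    ∀ x : N, h.inner x = g x
  smooth : ContMDiff I (I.prod 𝓘(ℝ, E →L[ℝ] E)) ∞
    (fun x : N ↦ Bundle.TotalSpace.mk' (E →L[ℝ] E)
      (E := fun x : N ↦ TangentSpace I x →L[ℝ] TangentSpace I x) x (F x))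
  involutive : ∀ (x : N) (u : TangentSpace I x), F x (F x u) = u
  ne_id : ∃ (x : N) (u : TangentSpace I x), F x u ≠ u
  ne_neg_id : ∃ (x : N) (u : TangentSpace I x), F x u ≠ -u
  pure : ∀ (x : N) (u v : TangentSpace I x), g x (F x u) v = g x u (F x v)

/-- `(N, F, g)` is a locally decomposable Riemannian manifold: an almost product Riemannian
manifold whose structure `F` is covariantly constant for the Levi-Civita connection of `g`. -/
structure IsLocallyDecomposable
    (g : ∀ x : N, TangentSpace I x →L[ℝ] TangentSpace I x →L[ℝ] ℝ)
    (F : ∀ x : N, TangentSpace I x →L[ℝ] TangentSpace I x) : Prop extends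
    IsAlmostProductRiemannian I g F where
  parallel : IsParallelEndo I g F

/-- The derivative `X(φ)` of a function in the direction of a vector field. -/
def dirDeriv (X : ∀ x : N, TangentSpace I x) (φ : N → ℝ) (x : N) : ℝ :=
  mfderiv I 𝓘(ℝ, ℝ) φ x (X x)

/-- The Lie derivative of an endomorphism field, `(L_Y F) X = [Y, F X] - F [Y, X]`. -/
def lieDerivEndo (Y : ∀ x : N, TangentSpace I x)
    (F : ∀ x : N, TangentSpace I x →L[ℝ] TangentSpace I x)
    (X : ∀ x : N, TangentSpace I x) (x : N) : TangentSpace I x :=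
  VectorField.mlieBracket I Y (fun z ↦ F z (X z)) x - F x (VectorField.mlieBracket I Y X x)

/-- The Tachibana operator
`(Φ_F g)(X, Y, Z) = (F X)(g(Y, Z)) - X(g(F Y, Z)) + g((L_Y F) X, Z) + g(Y, (L_Z F) X)`. -/
def phiOperator (F : ∀ x : N, TangentSpace I x →L[ℝ] TangentSpace I x)
    (g : ∀ x : N, TangentSpace I x →L[ℝ] TangentSpace I x →L[ℝ] ℝ)
    (X Y Z : ∀ x : N, TangentSpace I x) (x : N) : ℝ :=
  dirDeriv I (fun z ↦ F z (X z)) (fun z ↦ g z (Y z) (Z z)) x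
    - dirDeriv I X (fun z ↦ g z (F z (Y z)) (Z z)) x
    + g x (lieDerivEndo I Y F X x) (Z x) + g x (Y x) (lieDerivEndo I Z F X x)

/-- `Φ_F g = 0`, that is, `(Φ_F g)(X, Y, Z) = 0` for all smooth vector fields `X`, `Y`, `Z`. -/
def PhiVanishes (F : ∀ x : N, TangentSpace I x →L[ℝ] TangentSpace I x)
    (g : ∀ x : N, TangentSpace I x →L[ℝ] TangentSpace I x →L[ℝ] ℝ) : Prop :=
  ∀ X Y Z : ∀ x : N, TangentSpace I x,
    ContMDiff I I.tangent ∞ (fun x ↦ (⟨x, X x⟩ : TangentBundle I N)) →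
    ContMDiff I I.tangent ∞ (fun x ↦ (⟨x, Y x⟩ : TangentBundle I N)) →
    ContMDiff I I.tangent ∞ (fun x ↦ (⟨x, Z x⟩ : TangentBundle I N)) →
    ∀ x : N, phiOperator I F g X Y Z x = 0

end General

section Cotangent

variable (E : Type*) [NormedAddCommGroup E] [NormedSpace ℝ E]
  (M : Type*) [TopologicalSpace M] [ChartedSpace E M] [IsManifold 𝓘(ℝ, E) ∞ M]

/-- The cotangent bundle `T*M`, with Mathlib's manifold structure on the bundle of continuous
linear maps from the tangent bundle to `ℝ`. -/
abbrev CotangentBundle : Type _ :=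
  Bundle.TotalSpace (E →L[ℝ] ℝ) (fun x : M ↦ TangentSpace 𝓘(ℝ, E) x →L[ℝ] ℝ)

/-- The model with corners of the cotangent bundle. -/
abbrev cotangentModel :
    ModelWithCorners ℝ (E × (E →L[ℝ] ℝ)) (ModelProd E (E →L[ℝ] ℝ)) :=
  𝓘(ℝ, E).prod 𝓘(ℝ, E →L[ℝ] ℝ)

variable {E M}

/-! The tangent space of `T*M` at `p = (x, ξ)` is `E × (E →L[ℝ] ℝ)`, through the natural
coordinates `(x^i, p_i)` induced on `T*M` by the chart of `M` around `x`. -/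

/-- The vertical lift `ω_i ∂/∂p_i` at `p` of a covector `ω`. -/
def verticalLift (p : CotangentBundle E M) :
    (TangentSpace 𝓘(ℝ, E) p.proj →L[ℝ] ℝ) →L[ℝ] TangentSpace (cotangentModel E) p :=
  (ContinuousLinearMap.inr ℝ E (E →L[ℝ] ℝ) : (E →L[ℝ] ℝ) →L[ℝ] E × (E →L[ℝ] ℝ))

variable (g : Bundle.ContMDiffRiemannianMetric 𝓘(ℝ, E) ∞ E (fun x : M ↦ TangentSpace 𝓘(ℝ, E) x))

/-- At `p = (x, ξ)`, the map `X ↦ ξ ∘ Γ(X, ·) = p_h Γ^h_ij X^j`. -/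
def christoffelTerm (p : CotangentBundle E M) : E →L[ℝ] (E →L[ℝ] ℝ) :=
  (ContinuousLinearMap.compL ℝ E E ℝ (p.snd : E →L[ℝ] ℝ)).comp
    (christoffel 𝓘(ℝ, E) g.inner p.proj (extChartAt 𝓘(ℝ, E) p.proj p.proj))

/-- The horizontal lift `X^i ∂/∂x^i + p_h Γ^h_ij X^j ∂/∂p_i` at `p` of a tangent vector `X`. -/
def horizontalLift (p : CotangentBundle E M) :
    TangentSpace 𝓘(ℝ, E) p.proj →L[ℝ] TangentSpace (cotangentModel E) p :=
  ((ContinuousLinearMap.id ℝ E).prod (christoffelTerm g p) : E →L[ℝ] E × (E →L[ℝ] ℝ))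

/-- The horizontal part of a tangent vector of `T*M` (its image under the differential of the
projection `T*M → M`). -/
def horizontalPart (p : CotangentBundle E M) :
    TangentSpace (cotangentModel E) p →L[ℝ] TangentSpace 𝓘(ℝ, E) p.proj :=
  (ContinuousLinearMap.fst ℝ E (E →L[ℝ] ℝ) : E × (E →L[ℝ] ℝ) →L[ℝ] E)

/-- The vertical part of a tangent vector of `T*M`. -/
def verticalPart (p : CotangentBundle E M) :
    TangentSpace (cotangentModel E) p →L[ℝ] (TangentSpace 𝓘(ℝ, E) p.proj →L[ℝ] ℝ) :=
  (ContinuousLinearMap.snd ℝ E (E →L[ℝ] ℝ)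
    - (christoffelTerm g p).comp (ContinuousLinearMap.fst ℝ E (E →L[ℝ] ℝ)) :
    E × (E →L[ℝ] ℝ) →L[ℝ] (E →L[ℝ] ℝ))

theorem horizontalLift_add_verticalLift (p : CotangentBundle E M)
    (w : TangentSpace (cotangentModel E) p) :
    horizontalLift g p (horizontalPart p w) + verticalLift p (verticalPart g p w) = w := by
  change ((w.1, christoffelTerm g p w.1) + (0, w.2 - christoffelTerm g p w.1) :
    E × (E →L[ℝ] ℝ)) = w
  exact Prod.ext (add_zero _) (add_sub_cancel _ _)

/-- The almost product structure `J` on `T*M`, with `J(ᴴX) = -ᴴX` and `J(ⱽω) = ⱽω`. -/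
def cruceanuJ (p : CotangentBundle E M) :
    TangentSpace (cotangentModel E) p →L[ℝ] TangentSpace (cotangentModel E) p :=
  (verticalLift p).comp (verticalPart g p) - (horizontalLift g p).comp (horizontalPart p)

/-- The induced inner product `g⁻¹(ω, θ) = g^ij ω_i θ_j` on the cotangent space at `x`. -/
def cometric (x : M) :
    (TangentSpace 𝓘(ℝ, E) x →L[ℝ] ℝ) →L[ℝ] (TangentSpace 𝓘(ℝ, E) x →L[ℝ] ℝ) →L[ℝ] ℝ :=
  let G : E →L[ℝ] (E →L[ℝ] ℝ) := g.inner x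
  (ContinuousLinearMap.apply ℝ ℝ : E →L[ℝ] (E →L[ℝ] ℝ) →L[ℝ] ℝ).comp G.inverse

/-- The rescaled Riemannian metric of Cheeger-Gromoll type on `T*M`: at `p = (x, ξ)`, with
`α = 1 + g⁻¹(ξ, ξ)`, it is `f g` on horizontal vectors, the horizontal and the vertical vectors are
orthogonal, and `(ⱽω, ⱽθ) ↦ (g⁻¹(ω, θ) + g⁻¹(ω, ξ) g⁻¹(θ, ξ)) / α`. -/
def cheegerGromollMetric (f : M → ℝ) (p : CotangentBundle E M) :
    TangentSpace (cotangentModel E) p →L[ℝ] TangentSpace (cotangentModel E) p →L[ℝ] ℝ :=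
  let G : E →L[ℝ] E →L[ℝ] ℝ := g.inner p.proj
  let C : (E →L[ℝ] ℝ) →L[ℝ] (E →L[ℝ] ℝ) →L[ℝ] ℝ := cometric g p.proj
  let ξ : E →L[ℝ] ℝ := p.snd
  let h : E × (E →L[ℝ] ℝ) →L[ℝ] E := horizontalPart p
  let v : E × (E →L[ℝ] ℝ) →L[ℝ] (E →L[ℝ] ℝ) := verticalPart g p
  (f p.proj • G.bilinearComp h h
    + (1 + C ξ ξ)⁻¹ • (C.bilinearComp v v + ((C ξ).comp v).smulRight ((C ξ).comp v)) :
    E × (E →L[ℝ] ℝ) →L[ℝ] E × (E →L[ℝ] ℝ) →L[ℝ] ℝ)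

section Characterization

variable (p : CotangentBundle E M) (X Y : TangentSpace 𝓘(ℝ, E) p.proj)
  (a b : TangentSpace 𝓘(ℝ, E) p.proj →L[ℝ] ℝ) (f : M → ℝ)

@[simp] theorem horizontalPart_horizontalLift :
    horizontalPart p (horizontalLift g p X) = X := rfl

@[simp] theorem horizontalPart_verticalLift :
    horizontalPart p (verticalLift p a) = 0 := rfl

@[simp] theorem verticalPart_horizontalLift :
    verticalPart g p (horizontalLift g p X) = 0 :=
  sub_self (christoffelTerm g p X)

@[simp] theorem verticalPart_verticalLift :
    verticalPart g p (verticalLift p a) = a := by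
  have h : christoffelTerm g p (0 : E) = 0 := map_zero _
  exact (congrArg (fun c : E →L[ℝ] ℝ ↦ (show E →L[ℝ] ℝ from a) - c) h).trans (sub_zero (show E →L[ℝ] ℝ from a))

theorem cruceanuJ_horizontalLift :
    cruceanuJ g p (horizontalLift g p X) = -horizontalLift g p X := by
  change verticalLift p (verticalPart g p (horizontalLift g p X))
    - horizontalLift g p (horizontalPart p (horizontalLift g p X)) = _
  rw [verticalPart_horizontalLift, horizontalPart_horizontalLift, map_zero, zero_sub]

theorem cruceanuJ_verticalLift :
    cruceanuJ g p (verticalLift p a) = verticalLift p a := by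
  change verticalLift p (verticalPart g p (verticalLift p a))
    - horizontalLift g p (horizontalPart p (verticalLift p a)) = _
  rw [verticalPart_verticalLift, horizontalPart_verticalLift, map_zero, sub_zero]

theorem cheegerGromollMetric_apply (w w' : TangentSpace (cotangentModel E) p) :
    cheegerGromollMetric g f p w w'
      = f p.proj * g.inner p.proj (horizontalPart p w) (horizontalPart p w')
        + (1 + cometric g p.proj p.snd p.snd)⁻¹ *
          (cometric g p.proj (verticalPart g p w) (verticalPart g p w')
            + cometric g p.proj p.snd (verticalPart g p w)
              * cometric g p.proj p.snd (verticalPart g p w')) := rfl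

theorem cheegerGromollMetric_vertical_vertical :
    cheegerGromollMetric g f p (verticalLift p a) (verticalLift p b)
      = (1 + cometric g p.proj p.snd p.snd)⁻¹ * (cometric g p.proj a b
          + cometric g p.proj p.snd a * cometric g p.proj p.snd b) := by
  rw [cheegerGromollMetric_apply]
  simp only [horizontalPart_verticalLift, verticalPart_verticalLift, map_zero, mul_zero, zero_add]

theorem cheegerGromollMetric_vertical_horizontal :
    cheegerGromollMetric g f p (verticalLift p a) (horizontalLift g p Y) = 0 := by
  rw [cheegerGromollMetric_apply]
  simp only [horizontalPart_verticalLift, horizontalPart_horizontalLift,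
    verticalPart_horizontalLift, map_zero, mul_zero, add_zero,
    zero_apply]

theorem cheegerGromollMetric_horizontal_horizontal :
    cheegerGromollMetric g f p (horizontalLift g p X) (horizontalLift g p Y)
      = f p.proj * g.inner p.proj X Y := by
  rw [cheegerGromollMetric_apply]
  simp only [horizontalPart_horizontalLift, verticalPart_horizontalLift, map_zero, mul_zero,
    add_zero]

end Characterization

end Cotangent

end

/-! At a covector ξ write V for the vertical projection X ↦ X₂ - ξ∘Γ(X₁), G for the metric of T*M,
and h for the Cheeger-Gromoll inner product on the fibre. Everything rests on one formula,
`tachibana_model` (on the manifold, `tachibana_cotangent`): (Φ_J G)(X, Y, Z) = 2 h(ξ∘R(X₁, Y₁), V Z)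
+ 2 h(V Y, ξ∘R(X₁, Z₁)). Since J is -1 on horizontal vectors, the terms coming from f g cancel. The
fibre metric h is built from g⁻¹ and the tautological covector ξ, so it is parallel along horizontal
directions (`fderiv_modelFiberMetric_horizontal`). What is left is the derivative of V, which
measures the failure of the horizontal distribution to be integrable, that is, the curvature. Hence
R = 0 gives Φ = 0. Conversely, if ξ detects R(u, v) and η = ξ∘R(u, v), then taking for Y the
horizontal lift of v and for Z the vertical lift of η makes the right side 2 h(η, η) > 0.

Parallelism is equivalent to Φ = 0 for any pure pair (`parallel_iff_tachibana`). Koszul's formula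
gives 2 G((∇_Z J)X, Y) = Φ(X, Y, Z) + Φ(Y, X, Z), and purity makes Φ symmetric in its last two
arguments. A trilinear form antisymmetric in the first two arguments and symmetric in the last two
is zero. Local decomposability adds to parallelism only properties that hold for every g and every
positive smooth f.

The remaining work is the passage to coordinates. J and G are given at each p in the chart centred
at the base point of p, but derivatives need them near p in one fixed chart. That one formula serves
a whole chart (`endoInChart_cruceanuJ`, `bilinInChart_cheegerGromollMetric`) follows from the
transformation law of the Christoffel symbols. Finally Φ on vector fields is tensorial
(`phiOperator_eq_tachibana`), and every tangent vector extends to a global smooth field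
(`exists_contMDiff_vectorField`). -/

open scoped Manifold ContDiff Topology

noncomputable section

/-! ### Metrics on a vector space: Christoffel symbols, parallelism and the Tachibana operator -/

section FlatCalculus

variable {E : Type*} [NormedAddCommGroup E] [NormedSpace ℝ E]

/-- The Koszul form of a field of bilinear forms on a vector space. -/
def flatKoszul (B : E → E →L[ℝ] E →L[ℝ] ℝ) (y : E) : E →L[ℝ] E →L[ℝ] E →L[ℝ] ℝ :=
  let D : E →L[ℝ] E →L[ℝ] E →L[ℝ] ℝ := fderiv ℝ B y
  let flip₂ : (E →L[ℝ] E →L[ℝ] ℝ) →L[ℝ] (E →L[ℝ] E →L[ℝ] ℝ) :=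
    (ContinuousLinearMap.flipₗᵢ ℝ E E ℝ).toContinuousLinearEquiv.toContinuousLinearMap
  D + D.flip - flip₂.comp D.flip

/-- The Christoffel symbols of a field of bilinear forms on a vector space. -/
def flatChristoffel (B : E → E →L[ℝ] E →L[ℝ] ℝ) (y : E) : E →L[ℝ] E →L[ℝ] E :=
  (1 / 2 : ℝ) • (ContinuousLinearMap.compL ℝ E (E →L[ℝ] ℝ) E (B y).inverse).comp (flatKoszul B y)

/-- The Tachibana operator on constant vector fields of a vector space. -/
def tachibana (A : E → E →L[ℝ] E) (G : E → E →L[ℝ] E →L[ℝ] ℝ) (y X Y Z : E) : ℝ :=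
  fderiv ℝ G y (A y X) Y Z - fderiv ℝ G y X (A y Y) Z - G y (fderiv ℝ A y X Y) Z
    + G y (fderiv ℝ A y Y X) Z + G y Y (fderiv ℝ A y Z X)

theorem flatKoszul_apply (B : E → E →L[ℝ] E →L[ℝ] ℝ) (y u v w : E) :
    flatKoszul B y u v w
      = fderiv ℝ B y u v w + fderiv ℝ B y v u w - fderiv ℝ B y w u v := rfl

theorem flatChristoffel_apply (B : E → E →L[ℝ] E →L[ℝ] ℝ) (y u v : E) :
    flatChristoffel B y u v = (1 / 2 : ℝ) • (B y).inverse (flatKoszul B y u v) := rfl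

theorem ContinuousLinearMap.IsInvertible.apply_inverse {F : Type*} [NormedAddCommGroup F]
    [NormedSpace ℝ F] {T : E →L[ℝ] F} (h : T.IsInvertible) (v : F) : T (T.inverse v) = v := by
  obtain ⟨e, rfl⟩ := h
  simp

/-- Positivity makes the map to the dual injective, and the two dimensions agree. -/
theorem isInvertible_of_pos [FiniteDimensional ℝ E] {T : E →L[ℝ] E →L[ℝ] ℝ}
    (hT : ∀ v, v ≠ 0 → 0 < T v v) : T.IsInvertible := by
  have hinj : Function.Injective T.toLinearMap := by
    rw [← LinearMap.ker_eq_bot, LinearMap.ker_eq_bot']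
    intro v hv
    by_contra hne
    have h1 := hT v hne
    have h2 : T v v = 0 := by
      have : T v = 0 := hv
      rw [this]; rfl
    exact absurd h2 h1.ne'
  have hd : Module.finrank ℝ E = Module.finrank ℝ (E →L[ℝ] ℝ) := by
    rw [← (LinearMap.toContinuousLinearMap (𝕜 := ℝ) (E := E) (F' := ℝ)).finrank_eq]
    exact (Subspace.dual_finrank_eq (K := ℝ) (V := E)).symm
  exact ⟨(LinearEquiv.ofInjectiveOfFinrankEq T.toLinearMap hinj hd).toContinuousLinearEquiv,
    by ext; rfl⟩

section Christoffel

variable {B : E → E →L[ℝ] E →L[ℝ] ℝ} {y : E}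

theorem metric_flatChristoffel (h : (B y).IsInvertible) (u v w : E) :
    B y (flatChristoffel B y u v) w
      = 1 / 2 * (fderiv ℝ B y u v w + fderiv ℝ B y v u w - fderiv ℝ B y w u v) := by
  rw [flatChristoffel_apply, map_smul, smul_apply, h.apply_inverse,
    flatKoszul_apply, smul_eq_mul]

theorem fderiv_symm (hB : DifferentiableAt ℝ B y) (hs : ∀ᶠ z in 𝓝 y, ∀ v w, B z v w = B z w v)
    (u v w : E) : fderiv ℝ B y u v w = fderiv ℝ B y u w v := by
  have h1 : ∀ v w, HasFDerivAt (fun z ↦ B z v w) ((fderiv ℝ B y).flip v |>.flip w) y := by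
    intro v w
    have := ((hB.hasFDerivAt.clm_apply (hasFDerivAt_const v y)).clm_apply (hasFDerivAt_const w y))
    refine this.congr_fderiv ?_
    ext; simp
  have h2 := (h1 w v).congr_of_eventuallyEq (hs.mono fun z hz ↦ hz v w)
  exact DFunLike.congr_fun ((h1 v w).unique h2) u

/-- Metric compatibility of the Levi-Civita connection: in the sum of the two Koszul expressions the
derivatives in the directions v and w cancel by symmetry. -/
theorem fderiv_metric_eq (hB : DifferentiableAt ℝ B y) (h : (B y).IsInvertible)
    (hs : ∀ᶠ z in 𝓝 y, ∀ v w, B z v w = B z w v) (u v w : E) :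
    fderiv ℝ B y u v w
      = B y (flatChristoffel B y u v) w + B y v (flatChristoffel B y u w) := by
  rw [hs.self_of_nhds v, metric_flatChristoffel h, metric_flatChristoffel h,
    fderiv_symm hB hs u w v, fderiv_symm hB hs w u v, fderiv_symm hB hs v u w]
  ring

end Christoffel

/-- The Levi-Civita covariant derivative of `A` vanishes at `y` if and only if the Tachibana
operator does. -/
theorem parallel_iff_tachibana {A : E → E →L[ℝ] E} {G : E → E →L[ℝ] E →L[ℝ] ℝ} {y : E}
    (hA : DifferentiableAt ℝ A y) (hG : DifferentiableAt ℝ G y) (hi : (G y).IsInvertible)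
    (hs : ∀ᶠ z in 𝓝 y, ∀ v w, G z v w = G z w v)
    (hp : ∀ᶠ z in 𝓝 y, ∀ v w, G z (A z v) w = G z v (A z w)) :
    (∀ u v, fderiv ℝ A y u v + flatChristoffel G y u (A y v) - A y (flatChristoffel G y u v) = 0)
      ↔ ∀ X Y Z, tachibana A G y X Y Z = 0 := by
  -- Derivative of the purity relation G(Av, w) = G(v, Aw) in the direction u.
  have hpd : ∀ u v w, fderiv ℝ G y u (A y v) w + G y (fderiv ℝ A y u v) w
      = fderiv ℝ G y u v (A y w) + G y v (fderiv ℝ A y u w) := by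
    intro u v w
    have h1 := (hG.hasFDerivAt.clm_apply
      (hA.hasFDerivAt.clm_apply (hasFDerivAt_const v y))).clm_apply (hasFDerivAt_const w y)
    have h2 := (hG.hasFDerivAt.clm_apply (hasFDerivAt_const v y)).clm_apply
      (hA.hasFDerivAt.clm_apply (hasFDerivAt_const w y))
    have h3 := DFunLike.congr_fun (h1.unique (h2.congr_of_eventuallyEq
      (hp.mono fun z hz ↦ hz v w))) u
    simp at h3
    linarith
  -- Koszul's formula evaluates both Christoffel terms once purity has moved A onto the other
  -- argument; the derivatives of A are then matched by `hpd`.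
  have key : ∀ X Y Z, 2 * G y (fderiv ℝ A y Z X + flatChristoffel G y Z (A y X)
      - A y (flatChristoffel G y Z X)) Y = tachibana A G y X Y Z + tachibana A G y Y X Z := by
    intro X Y Z
    have p := hp.self_of_nhds
    have s := hs.self_of_nhds
    simp only [map_add, map_sub, add_apply, sub_apply]
    rw [p, metric_flatChristoffel hi, metric_flatChristoffel hi]
    unfold tachibana
    have e1 := hpd Z X Y
    have e2 := hpd X Y Z
    have e3 := hpd Y X Z
    have q := fderiv_symm hG hs
    linarith [q (A y X) Z Y, q Y Z (A y X), q X Z (A y Y), q (A y Y) Z X, q Z Y (A y X),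
      s Y (fderiv ℝ A y Z X), s X (fderiv ℝ A y Z Y), s Y (A y (flatChristoffel G y Z X))]
  have hsymm : ∀ X Y Z, tachibana A G y X Y Z = tachibana A G y X Z Y := by
    intro X Y Z
    have s := hs.self_of_nhds
    have q := fderiv_symm hG hs
    have e := hpd X Y Z
    unfold tachibana
    linarith [q (A y X) Y Z, q X (A y Z) Y, s (fderiv ℝ A y Y X) Z, s Y (fderiv ℝ A y Z X),
      s (fderiv ℝ A y X Z) Y]
  constructor
  · intro h
    -- Antisymmetry in the first pair and symmetry in the last pair, applied alternately three times
    -- each, bring (X, Y, Z) back to itself with the opposite sign.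
    have ha : ∀ X Y Z, tachibana A G y X Y Z = -tachibana A G y Y X Z := by
      intro X Y Z
      have := key X Y Z
      rw [h, map_zero, zero_apply] at this
      linarith
    intro X Y Z
    linarith [ha X Y Z, hsymm Y X Z, ha Y Z X, hsymm Z Y X, ha Z X Y, hsymm X Z Y]
  · intro h u v
    apply hi.injective
    ext w
    have := key v w u
    rw [h, h] at this
    rw [map_zero, zero_apply]
    linarith

end FlatCalculus

/-! ### Change of coordinates, and the model structures on E × E* -/

section FlatCalculus

variable {E : Type*} [NormedAddCommGroup E] [NormedSpace ℝ E]

/-- The transformation law of the Christoffel symbols under a change of coordinates. -/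
theorem flatChristoffel_pullback {B B₀ : E → E →L[ℝ] E →L[ℝ] ℝ} {τ : E → E} {y : E}
    (hτ : ContDiffAt ℝ 2 τ y) (hB : DifferentiableAt ℝ B (τ y))
    (hs : ∀ᶠ z in 𝓝 (τ y), ∀ v w, B z v w = B z w v)
    (hi : (B (τ y)).IsInvertible) (hi₀ : (B₀ y).IsInvertible)
    (hL : Function.Surjective (fderiv ℝ τ y))
    (h : ∀ᶠ z in 𝓝 y, ∀ v w, B₀ z v w = B (τ z) (fderiv ℝ τ z v) (fderiv ℝ τ z w)) (u v : E) :
    fderiv ℝ τ y (flatChristoffel B₀ y u v)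
      = flatChristoffel B (τ y) (fderiv ℝ τ y u) (fderiv ℝ τ y v)
        + fderiv ℝ (fderiv ℝ τ) y u v := by
  have hτ1 : DifferentiableAt ℝ τ y := hτ.differentiableAt (by norm_num)
  have hτ2 : DifferentiableAt ℝ (fderiv ℝ τ) y :=
    (hτ.fderiv_right (m := 1) (by norm_num)).differentiableAt (by norm_num)
  have hsymm : ∀ u v, fderiv ℝ (fderiv ℝ τ) y u v = fderiv ℝ (fderiv ℝ τ) y v u :=
    fun u v ↦ hτ.isSymmSndFDerivAt (by simp) u v
  -- Near y, B₀ is the pullback of B, whose ingredients are differentiable.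
  have hB₀ : DifferentiableAt ℝ B₀ y := by
    have hd : DifferentiableAt ℝ
        (fun z ↦ (B (τ z)).bilinearComp (fderiv ℝ τ z) (fderiv ℝ τ z)) y := by
      have h1 : DifferentiableAt ℝ (fun z ↦ B (τ z)) y := hB.comp y hτ1
      have h2 := (h1.clm_comp hτ2)
      have h3 := (ContinuousLinearMap.flipₗᵢ ℝ E E ℝ).toContinuousLinearEquiv.differentiableAt.comp
        y h2
      have h4 := h3.clm_comp hτ2
      exact (ContinuousLinearMap.flipₗᵢ ℝ E E ℝ).toContinuousLinearEquiv.differentiableAt.comp y h4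
    refine hd.congr_of_eventuallyEq (h.mono fun z hz ↦ ?_)
    ext v w
    exact hz v w
  have hD : ∀ u v w, fderiv ℝ B₀ y u v w
      = fderiv ℝ B (τ y) (fderiv ℝ τ y u) (fderiv ℝ τ y v) (fderiv ℝ τ y w)
        + B (τ y) (fderiv ℝ (fderiv ℝ τ) y u v) (fderiv ℝ τ y w)
        + B (τ y) (fderiv ℝ τ y v) (fderiv ℝ (fderiv ℝ τ) y u w) := by
    intro u v w
    have h1 := (hB₀.hasFDerivAt.clm_apply (hasFDerivAt_const v y)).clm_apply (hasFDerivAt_const w y)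
    have h2 := ((hB.hasFDerivAt.comp y hτ1.hasFDerivAt).clm_apply
      (hτ2.hasFDerivAt.clm_apply (hasFDerivAt_const v y))).clm_apply
      (hτ2.hasFDerivAt.clm_apply (hasFDerivAt_const w y))
    have h3 := DFunLike.congr_fun (h1.unique (h2.congr_of_eventuallyEq
      (h.mono fun z hz ↦ hz v w))) u
    simp at h3
    linarith
  apply hi.injective
  ext w
  obtain ⟨w, rfl⟩ := hL w
  have s := hs.self_of_nhds
  rw [← h.self_of_nhds, metric_flatChristoffel hi₀, map_add, add_apply, metric_flatChristoffel hi,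
    hD, hD, hD]
  -- Once d²τ is symmetric, the six second-derivative terms of the Koszul combination collapse to 2
  -- B(d²τ(u, v), dτ w).
  rw [hsymm v u, hsymm w u, hsymm w v]
  linarith [s (fderiv ℝ τ y v) (fderiv ℝ (fderiv ℝ τ) y u w),
    s (fderiv ℝ τ y u) (fderiv ℝ (fderiv ℝ τ) y v w)]

variable (B : E → E →L[ℝ] E →L[ℝ] ℝ) (φ : E → ℝ)

/-- The map `u ↦ ξ ∘ Γ(u, ·)` at `(y, ξ)`. -/
def modelChristoffelTerm (z : E × (E →L[ℝ] ℝ)) : E →L[ℝ] (E →L[ℝ] ℝ) :=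
  (ContinuousLinearMap.compL ℝ E E ℝ z.2).comp (flatChristoffel B z.1)

/-- The vertical projection `(u, η) ↦ η - ξ ∘ Γ(u, ·)` at `(y, ξ)`. -/
def modelVertical (z : E × (E →L[ℝ] ℝ)) : E × (E →L[ℝ] ℝ) →L[ℝ] (E →L[ℝ] ℝ) :=
  ContinuousLinearMap.snd ℝ E (E →L[ℝ] ℝ)
    - (modelChristoffelTerm B z).comp (ContinuousLinearMap.fst ℝ E (E →L[ℝ] ℝ))

/-- The almost product structure in natural coordinates of the cotangent bundle. -/
def modelJ (z : E × (E →L[ℝ] ℝ)) : E × (E →L[ℝ] ℝ) →L[ℝ] E × (E →L[ℝ] ℝ) :=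
  (ContinuousLinearMap.inr ℝ E (E →L[ℝ] ℝ)).comp (modelVertical B z)
    - ((ContinuousLinearMap.id ℝ E).prod (modelChristoffelTerm B z)).comp
      (ContinuousLinearMap.fst ℝ E (E →L[ℝ] ℝ))

/-- The inverse metric. -/
def flatCometric (y : E) : (E →L[ℝ] ℝ) →L[ℝ] (E →L[ℝ] ℝ) →L[ℝ] ℝ :=
  (ContinuousLinearMap.apply ℝ ℝ : E →L[ℝ] (E →L[ℝ] ℝ) →L[ℝ] ℝ).comp (B y).inverse

/-- The metric of Cheeger-Gromoll type on the vertical space at `(y, ξ)`. -/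
def modelFiberMetric (z : E × (E →L[ℝ] ℝ)) : (E →L[ℝ] ℝ) →L[ℝ] (E →L[ℝ] ℝ) →L[ℝ] ℝ :=
  (1 + flatCometric B z.1 z.2 z.2)⁻¹ • (flatCometric B z.1
    + (flatCometric B z.1 z.2).smulRight (flatCometric B z.1 z.2))

/-- The metric of Cheeger-Gromoll type in natural coordinates of the cotangent bundle. -/
def modelMetric (z : E × (E →L[ℝ] ℝ)) : E × (E →L[ℝ] ℝ) →L[ℝ] E × (E →L[ℝ] ℝ) →L[ℝ] ℝ :=
  φ z.1 • (B z.1).bilinearComp (ContinuousLinearMap.fst ℝ E (E →L[ℝ] ℝ))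
      (ContinuousLinearMap.fst ℝ E (E →L[ℝ] ℝ))
    + (modelFiberMetric B z).bilinearComp (modelVertical B z) (modelVertical B z)

/-- The curvature of a field of bilinear forms on a vector space. -/
def flatCurvature (y u v : E) : E →L[ℝ] E :=
  fderiv ℝ (flatChristoffel B) y u v - fderiv ℝ (flatChristoffel B) y v u
    + (flatChristoffel B y u).comp (flatChristoffel B y v)
    - (flatChristoffel B y v).comp (flatChristoffel B y u)

variable {B φ}

theorem modelVertical_apply (z X : E × (E →L[ℝ] ℝ)) :
    modelVertical B z X = X.2 - z.2.comp (flatChristoffel B z.1 X.1) := rfl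

theorem modelJ_apply (z X : E × (E →L[ℝ] ℝ)) :
    modelJ B z X = (-X.1, modelVertical B z X - z.2.comp (flatChristoffel B z.1 X.1)) := by
  ext <;> simp [modelJ, modelChristoffelTerm]

theorem modelVertical_modelJ (z X : E × (E →L[ℝ] ℝ)) :
    modelVertical B z (modelJ B z X) = modelVertical B z X := by
  rw [modelVertical_apply, modelJ_apply]
  simp

theorem flatCometric_apply (y : E) (η θ : E →L[ℝ] ℝ) :
    flatCometric B y η θ = θ ((B y).inverse η) := rfl

theorem modelFiberMetric_apply (z : E × (E →L[ℝ] ℝ)) (η θ : E →L[ℝ] ℝ) :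
    modelFiberMetric B z η θ = (1 + flatCometric B z.1 z.2 z.2)⁻¹ *
      (flatCometric B z.1 η θ + flatCometric B z.1 z.2 η * flatCometric B z.1 z.2 θ) := rfl

theorem modelMetric_apply (z X Y : E × (E →L[ℝ] ℝ)) :
    modelMetric B φ z X Y = φ z.1 * B z.1 X.1 Y.1
      + modelFiberMetric B z (modelVertical B z X) (modelVertical B z Y) := rfl

theorem modelMetric_pure (z X Y : E × (E →L[ℝ] ℝ)) :
    modelMetric B φ z (modelJ B z X) Y = modelMetric B φ z X (modelJ B z Y) := by
  simp only [modelMetric_apply, modelVertical_modelJ]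
  simp only [modelJ_apply, map_neg, neg_apply]

theorem modelJ_modelJ (z X : E × (E →L[ℝ] ℝ)) : modelJ B z (modelJ B z X) = X := by
  rw [modelJ_apply, modelVertical_modelJ, modelJ_apply, modelVertical_apply]
  ext <;> simp

theorem flatCometric_symm {y : E} (hi : (B y).IsInvertible) (hs : ∀ v w, B y v w = B y w v)
    (η θ : E →L[ℝ] ℝ) : flatCometric B y η θ = flatCometric B y θ η := by
  rw [flatCometric_apply, flatCometric_apply]
  conv_lhs => rw [← hi.apply_inverse θ, hs, hi.apply_inverse]

/-- Raising the index of η gives a nonzero vector whose B-square is the cometric square of η. -/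
theorem flatCometric_self_pos {y : E} (hi : (B y).IsInvertible)
    (hp : ∀ v, v ≠ 0 → 0 < B y v v) {η : E →L[ℝ] ℝ} (hη : η ≠ 0) : 0 < flatCometric B y η η := by
  rw [flatCometric_apply]
  conv_rhs => rw [← hi.apply_inverse η, hi.apply_inverse]
  have := hp ((B y).inverse η) (fun h ↦ hη (by rw [← hi.apply_inverse η, h, map_zero]))
  rwa [hi.apply_inverse] at this

theorem flatCometric_self_nonneg {y : E} (hi : (B y).IsInvertible)
    (hp : ∀ v, v ≠ 0 → 0 < B y v v) (η : E →L[ℝ] ℝ) : 0 ≤ flatCometric B y η η := by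
  rcases eq_or_ne η 0 with rfl | h
  · simp
  · exact (flatCometric_self_pos hi hp h).le

theorem modelFiberMetric_symm {z : E × (E →L[ℝ] ℝ)} (hi : (B z.1).IsInvertible)
    (hs : ∀ v w, B z.1 v w = B z.1 w v) (η θ : E →L[ℝ] ℝ) :
    modelFiberMetric B z η θ = modelFiberMetric B z θ η := by
  rw [modelFiberMetric_apply, modelFiberMetric_apply, flatCometric_symm hi hs η θ, mul_comm
    (flatCometric B z.1 z.2 η)]

theorem modelFiberMetric_self_pos {z : E × (E →L[ℝ] ℝ)} (hi : (B z.1).IsInvertible)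
    (hp : ∀ v, v ≠ 0 → 0 < B z.1 v v) {η : E →L[ℝ] ℝ} (hη : η ≠ 0) :
    0 < modelFiberMetric B z η η := by
  rw [modelFiberMetric_apply]
  have h1 := flatCometric_self_pos hi hp hη
  have h2 := flatCometric_self_nonneg hi hp z.2
  have h3 := mul_self_nonneg (flatCometric B z.1 z.2 η)
  positivity

theorem modelMetric_symm {z : E × (E →L[ℝ] ℝ)} (hi : (B z.1).IsInvertible)
    (hs : ∀ v w, B z.1 v w = B z.1 w v) (X Y : E × (E →L[ℝ] ℝ)) :
    modelMetric B φ z X Y = modelMetric B φ z Y X := by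
  rw [modelMetric_apply, modelMetric_apply, modelFiberMetric_symm hi hs, hs]

/-- The base component and the vertical part together determine X, so at least one of the two
nonnegative summands is strictly positive. -/
theorem modelMetric_self_pos {z : E × (E →L[ℝ] ℝ)} (hi : (B z.1).IsInvertible)
    (hp : ∀ v, v ≠ 0 → 0 < B z.1 v v) (hφ : 0 < φ z.1) {X : E × (E →L[ℝ] ℝ)} (hX : X ≠ 0) :
    0 < modelMetric B φ z X X := by
  rw [modelMetric_apply]
  rcases eq_or_ne X.1 0 with h | h
  · have h' : modelVertical B z X ≠ 0 := by
      rw [modelVertical_apply, h]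
      intro h0
      refine hX (Prod.ext h ?_)
      simpa using h0
    have := modelFiberMetric_self_pos hi hp h'
    rw [h]
    simpa using this
  · have h1 := mul_pos hφ (hp _ h)
    rcases eq_or_ne (modelVertical B z X) 0 with h' | h'
    · rw [h']; simpa using h1
    · linarith [modelFiberMetric_self_pos hi hp h']

end FlatCalculus

/-! ### Smoothness of the model structures and the curvature formula for Φ -/

section FlatCalculus

/-- A basis of E identifies `E →L[ℝ] F` with a finite power of F. This lets smoothness of bilinear
forms be checked entry by entry. -/
theorem contDiffAt_clm_apply_iff {D E F : Type*} [NormedAddCommGroup D] [NormedSpace ℝ D]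
    [NormedAddCommGroup E] [NormedSpace ℝ E] [FiniteDimensional ℝ E] [NormedAddCommGroup F]
    [NormedSpace ℝ F] {n : WithTop ℕ∞} {f : D → E →L[ℝ] F} {x : D} :
    ContDiffAt ℝ n f x ↔ ∀ y, ContDiffAt ℝ n (fun z ↦ f z y) x := by
  refine ⟨fun h y ↦ h.clm_apply contDiffAt_const, fun h ↦ ?_⟩
  let d := Module.finrank ℝ E
  have hd : d = Module.finrank ℝ (Fin d → ℝ) := (Module.finrank_fin_fun ℝ).symm
  let e₁ := ContinuousLinearEquiv.ofFinrankEq hd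
  let e₂ := (e₁.arrowCongr (1 : F ≃L[ℝ] F)).trans (ContinuousLinearEquiv.piRing (Fin d))
  rw [← e₂.comp_contDiffAt_iff]
  exact contDiffAt_pi.mpr fun i ↦ h _

variable {E : Type*} [NormedAddCommGroup E] [NormedSpace ℝ E]
  {B : E → E →L[ℝ] E →L[ℝ] ℝ} {φ : E → ℝ}

theorem contDiffAt_flatChristoffel [CompleteSpace E] {y : E} (hB : ContDiffAt ℝ ∞ B y)
    (hi : (B y).IsInvertible) : ContDiffAt ℝ ∞ (flatChristoffel B) y := by
  have h1 : ContDiffAt ℝ ∞ (fun z ↦ (B z).inverse) y := hi.contDiffAt_map_inverse.comp y hB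
  have h2 : ContDiffAt ℝ ∞ (fderiv ℝ B) y := hB.fderiv_right (m := ∞) (by simp)
  have h3 : ContDiffAt ℝ ∞ (fun z ↦ (fderiv ℝ B z).flip) y :=
    (ContinuousLinearMap.flipₗᵢ ℝ E E (E →L[ℝ] ℝ)).contDiff.contDiffAt.comp y h2
  have h4 : ContDiffAt ℝ ∞ (flatKoszul B) y :=
    (h2.add h3).sub (contDiffAt_const.clm_comp h3)
  have h5 : ContDiffAt ℝ ∞ (fun z ↦ ContinuousLinearMap.compL ℝ E (E →L[ℝ] ℝ) E (B z).inverse) y :=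
    (ContinuousLinearMap.compL ℝ E (E →L[ℝ] ℝ) E).contDiff.contDiffAt.comp y h1
  exact (h5.clm_comp h4).const_smul (1 / 2 : ℝ)

theorem contDiffAt_modelVertical [CompleteSpace E] {z : E × (E →L[ℝ] ℝ)}
    (hB : ContDiffAt ℝ ∞ B z.1) (hi : (B z.1).IsInvertible) :
    ContDiffAt ℝ ∞ (modelVertical B) z := by
  have h1 : ContDiffAt ℝ ∞ (fun z : E × (E →L[ℝ] ℝ) ↦ flatChristoffel B z.1) z :=
    (contDiffAt_flatChristoffel hB hi).comp z contDiffAt_fst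
  have h2 : ContDiffAt ℝ ∞ (fun z : E × (E →L[ℝ] ℝ) ↦ ContinuousLinearMap.compL ℝ E E ℝ z.2) z :=
    (ContinuousLinearMap.compL ℝ E E ℝ).contDiff.contDiffAt.comp z contDiffAt_snd
  have h3 : ContDiffAt ℝ ∞ (modelChristoffelTerm B) z := h2.clm_comp h1
  exact contDiffAt_const.sub (h3.clm_comp contDiffAt_const)

theorem contDiffAt_modelJ [CompleteSpace E] {z : E × (E →L[ℝ] ℝ)}
    (hB : ContDiffAt ℝ ∞ B z.1) (hi : (B z.1).IsInvertible) :
    ContDiffAt ℝ ∞ (modelJ B) z := by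
  -- J is the reflection 2P - id, with P the projection onto the vertical space.
  have h : ContDiffAt ℝ ∞ (fun z ↦ (2 : ℝ) • (ContinuousLinearMap.inr ℝ E (E →L[ℝ] ℝ)).comp
      (modelVertical B z) - ContinuousLinearMap.id ℝ (E × (E →L[ℝ] ℝ))) z :=
    ((contDiffAt_const.clm_comp (contDiffAt_modelVertical hB hi)).const_smul (2 : ℝ)).sub
      contDiffAt_const
  convert h using 1
  funext z
  refine ContinuousLinearMap.ext fun X ↦ ?_
  rw [modelJ_apply, modelVertical_apply]
  refine Prod.ext ?_ ?_
  · simp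
  · simp [modelVertical_apply, two_smul]
    abel

theorem contDiffAt_flatCometric [CompleteSpace E] {y : E}
    (hB : ContDiffAt ℝ ∞ B y) (hi : (B y).IsInvertible) :
    ContDiffAt ℝ ∞ (flatCometric B) y :=
  contDiffAt_const.clm_comp (hi.contDiffAt_map_inverse.comp y hB)

theorem contDiffAt_modelFiberMetric [FiniteDimensional ℝ E] {z : E × (E →L[ℝ] ℝ)}
    (hB : ContDiffAt ℝ ∞ B z.1) (hi : (B z.1).IsInvertible) (hp : ∀ v, v ≠ 0 → 0 < B z.1 v v) :
    ContDiffAt ℝ ∞ (modelFiberMetric B) z := by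
  have := FiniteDimensional.complete ℝ E
  have hC : ContDiffAt ℝ ∞ (fun z : E × (E →L[ℝ] ℝ) ↦ flatCometric B z.1) z :=
    (contDiffAt_flatCometric hB hi).comp z contDiffAt_fst
  have hξ := hC.clm_apply contDiffAt_snd
  rw [contDiffAt_clm_apply_iff]
  intro η
  rw [contDiffAt_clm_apply_iff]
  intro θ
  have h0 := flatCometric_self_nonneg hi hp z.2
  have hη : ContDiffAt ℝ ∞ (fun _ : E × (E →L[ℝ] ℝ) ↦ η) z := contDiffAt_const
  have hθ : ContDiffAt ℝ ∞ (fun _ : E × (E →L[ℝ] ℝ) ↦ θ) z := contDiffAt_const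
  exact ((contDiffAt_const.add (hξ.clm_apply contDiffAt_snd)).inv (by positivity)).mul
    (((hC.clm_apply hη).clm_apply hθ).add ((hξ.clm_apply hη).mul (hξ.clm_apply hθ)))

theorem contDiffAt_modelMetric [FiniteDimensional ℝ E] {z : E × (E →L[ℝ] ℝ)}
    (hB : ContDiffAt ℝ ∞ B z.1) (hi : (B z.1).IsInvertible) (hp : ∀ v, v ≠ 0 → 0 < B z.1 v v)
    (hφ : ContDiffAt ℝ ∞ φ z.1) : ContDiffAt ℝ ∞ (modelMetric B φ) z := by
  have := FiniteDimensional.complete ℝ E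
  rw [contDiffAt_clm_apply_iff]
  intro X
  rw [contDiffAt_clm_apply_iff]
  intro Y
  have hV := contDiffAt_modelVertical hB hi
  have hX := hV.clm_apply (contDiffAt_const (c := X))
  have hY := hV.clm_apply (contDiffAt_const (c := Y))
  have hB' : ContDiffAt ℝ ∞ (fun z : E × (E →L[ℝ] ℝ) ↦ B z.1) z := hB.comp z contDiffAt_fst
  have hφ' : ContDiffAt ℝ ∞ (fun z : E × (E →L[ℝ] ℝ) ↦ φ z.1) z := hφ.comp z contDiffAt_fst
  exact (hφ'.mul ((hB'.clm_apply contDiffAt_const).clm_apply contDiffAt_const)).add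
    (((contDiffAt_modelFiberMetric hB hi hp).clm_apply hX).clm_apply hY)

theorem hasFDerivAt_clm_apply_apply {V F G H : Type*} [NormedAddCommGroup V] [NormedSpace ℝ V]
    [NormedAddCommGroup F] [NormedSpace ℝ F] [NormedAddCommGroup G] [NormedSpace ℝ G]
    [NormedAddCommGroup H] [NormedSpace ℝ H] {T : V → F →L[ℝ] G →L[ℝ] H} {z : V}
    (hT : DifferentiableAt ℝ T z) (v : F) (w : G) :
    HasFDerivAt (fun x ↦ T x v w) (((fderiv ℝ T z).flip v).flip w) z := by
  refine ((hT.hasFDerivAt.clm_apply (hasFDerivAt_const v z)).clm_apply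
    (hasFDerivAt_const w z)).congr_fderiv ?_
  ext; simp

/-- The inverse metric is parallel because the metric is: differentiating B(B⁻¹η) = η gives the
derivative of B⁻¹η in terms of ∂B, and metric compatibility replaces ∂B by Christoffel symbols. -/
theorem fderiv_flatCometric [CompleteSpace E] {y : E} (hB : ContDiffAt ℝ ∞ B y)
    (hi : (B y).IsInvertible) (hs : ∀ᶠ z in 𝓝 y, ∀ v w, B z v w = B z w v)
    (hinv : ∀ᶠ z in 𝓝 y, (B z).IsInvertible)
    (u : E) (η θ : E →L[ℝ] ℝ) :
    fderiv ℝ (flatCometric B) y u η θ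
      = -flatCometric B y (η.comp (flatChristoffel B y u)) θ
        - flatCometric B y η (θ.comp (flatChristoffel B y u)) := by
  have hB1 : DifferentiableAt ℝ B y := hB.differentiableAt (by simp)
  have hI : DifferentiableAt ℝ (fun z ↦ (B z).inverse) y :=
    (hi.contDiffAt_map_inverse.comp y hB : ContDiffAt ℝ ∞ _ y).differentiableAt (by simp)
  have hc : HasFDerivAt (fun z ↦ (B z).inverse η) ((fderiv ℝ (fun z ↦ (B z).inverse) y).flip η) y := by
    refine (hI.hasFDerivAt.clm_apply (hasFDerivAt_const η y)).congr_fderiv ?_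
    ext; simp
  have hC : DifferentiableAt ℝ (flatCometric B) y :=
    (contDiffAt_flatCometric hB hi).differentiableAt (by simp)
  set c' := (fderiv ℝ (fun z ↦ (B z).inverse) y).flip η
  have e1 : fderiv ℝ (flatCometric B) y u η θ = θ (c' u) := by
    have h1 := hasFDerivAt_clm_apply_apply hC η θ
    have h2 : HasFDerivAt (fun z ↦ flatCometric B z η θ) (θ.comp c') y :=
      θ.hasFDerivAt.comp y hc
    exact DFunLike.congr_fun (h1.unique h2) u
  have e2 : ∀ v, fderiv ℝ B y u ((B y).inverse η) v + B y (c' u) v = 0 := by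
    intro v
    have h1 := (hB1.hasFDerivAt.clm_apply hc).clm_apply (hasFDerivAt_const v y)
    have h2 : HasFDerivAt (fun z ↦ B z ((B z).inverse η) v) (0 : E →L[ℝ] ℝ) y :=
      (hasFDerivAt_const (η v) y).congr_of_eventuallyEq
        (hinv.mono fun z hz ↦ by simp only [hz.apply_inverse])
    have := DFunLike.congr_fun (h1.unique h2) u
    simp at this
    linarith
  have e3 : c' u = -flatChristoffel B y u ((B y).inverse η)
      - (B y).inverse (η.comp (flatChristoffel B y u)) := by
    apply hi.injective
    ext v
    have := e2 v
    rw [fderiv_metric_eq hB1 hi hs, hi.apply_inverse] at this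
    rw [map_sub, map_neg, hi.apply_inverse]
    simp only [sub_apply, neg_apply, ContinuousLinearMap.comp_apply]
    linarith
  rw [e1, e3]
  simp only [map_sub, map_neg, flatCometric_apply, ContinuousLinearMap.comp_apply]
  ring

/-- Along a horizontal direction the covector ξ is parallel transported and g⁻¹ is parallel, so 1 +
g⁻¹(ξ, ξ) has derivative zero and the whole fibre metric, made of g⁻¹ and ξ, is parallel as well. -/
theorem fderiv_modelFiberMetric_horizontal [FiniteDimensional ℝ E] {z : E × (E →L[ℝ] ℝ)}
    (hB : ContDiffAt ℝ ∞ B z.1)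
    (hi : (B z.1).IsInvertible) (hp : ∀ v, v ≠ 0 → 0 < B z.1 v v)
    (hs : ∀ᶠ y in 𝓝 z.1, ∀ v w, B y v w = B y w v)
    (hinv : ∀ᶠ y in 𝓝 z.1, (B y).IsInvertible)
    (u : E) (η θ : E →L[ℝ] ℝ) :
    fderiv ℝ (modelFiberMetric B) z (u, z.2.comp (flatChristoffel B z.1 u)) η θ
      = -modelFiberMetric B z (η.comp (flatChristoffel B z.1 u)) θ
        - modelFiberMetric B z η (θ.comp (flatChristoffel B z.1 u)) := by
  have := FiniteDimensional.complete ℝ E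
  have hC0 : HasFDerivAt (flatCometric B) (fderiv ℝ (flatCometric B) z.1) z.1 :=
    ((contDiffAt_flatCometric hB hi).differentiableAt (by simp)).hasFDerivAt
  have hC := hC0.comp z (hasFDerivAt_fst (𝕜 := ℝ) (E := E) (F := E →L[ℝ] ℝ) (p := z))
  have hsnd := hasFDerivAt_snd (𝕜 := ℝ) (E := E) (F := E →L[ℝ] ℝ) (p := z)
  have hξ := hC.clm_apply hsnd
  have hξξ := (hξ.clm_apply hsnd).const_add 1
  have hξη := hξ.clm_apply (hasFDerivAt_const η z)
  have hξθ := hξ.clm_apply (hasFDerivAt_const θ z)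
  have hηθ := (hC.clm_apply (hasFDerivAt_const η z)).clm_apply (hasFDerivAt_const θ z)
  have h0 := flatCometric_self_nonneg hi hp z.2
  have hne : 1 + flatCometric B z.1 z.2 z.2 ≠ 0 := by positivity
  have h1 := (((hasDerivAt_inv hne).comp_hasFDerivAt z hξξ)).mul (hηθ.add (hξη.mul hξθ))
  have h2 := hasFDerivAt_clm_apply_apply
    ((contDiffAt_modelFiberMetric hB hi hp).differentiableAt (by simp)) η θ
  have h3 := DFunLike.congr_fun (h2.unique h1) (u, z.2.comp (flatChristoffel B z.1 u))
  have hd := fderiv_flatCometric hB hi hs hinv u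
  have hsm := flatCometric_symm hi hs.self_of_nhds
  simp [hd] at h3
  rw [h3]
  simp only [modelFiberMetric_apply]
  rw [hsm z.2 (z.2.comp _)]
  ring

/-- The Tachibana operator of the model structures, expressed through the curvature. -/
theorem tachibana_model [FiniteDimensional ℝ E] {z : E × (E →L[ℝ] ℝ)}
    (hB : ContDiffAt ℝ ∞ B z.1) (hφ : ContDiffAt ℝ ∞ φ z.1)
    (hi : (B z.1).IsInvertible) (hp : ∀ v, v ≠ 0 → 0 < B z.1 v v)
    (hs : ∀ᶠ y in 𝓝 z.1, ∀ v w, B y v w = B y w v)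
    (hinv : ∀ᶠ y in 𝓝 z.1, (B y).IsInvertible)
    (X Y Z : E × (E →L[ℝ] ℝ)) :
    tachibana (modelJ B) (modelMetric B φ) z X Y Z
      = 2 * modelFiberMetric B z (z.2.comp (flatCurvature B z.1 X.1 Y.1)) (modelVertical B z Z)
        + 2 * modelFiberMetric B z (modelVertical B z Y)
          (z.2.comp (flatCurvature B z.1 X.1 Z.1)) := by
  have := FiniteDimensional.complete ℝ E
  have hV : DifferentiableAt ℝ (modelVertical B) z :=
    (contDiffAt_modelVertical hB hi).differentiableAt (by simp)
  have hJ : DifferentiableAt ℝ (modelJ B) z :=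
    (contDiffAt_modelJ hB hi).differentiableAt (by simp)
  have hG : DifferentiableAt ℝ (modelMetric B φ) z :=
    (contDiffAt_modelMetric hB hi hp hφ).differentiableAt (by simp)
  have ha : DifferentiableAt ℝ (modelFiberMetric B) z :=
    (contDiffAt_modelFiberMetric hB hi hp).differentiableAt (by simp)
  have hΓ : DifferentiableAt ℝ (flatChristoffel B) z.1 :=
    (contDiffAt_flatChristoffel hB hi).differentiableAt (by simp)
  set D := fderiv ℝ (modelVertical B) z with hD
  have hDX : ∀ X Y, D X Y = -X.2.comp (flatChristoffel B z.1 Y.1)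
      - z.2.comp (fderiv ℝ (flatChristoffel B) z.1 X.1 Y.1) := by
    intro X Y
    have h1 := hV.hasFDerivAt.clm_apply (hasFDerivAt_const Y z)
    have h2 : HasFDerivAt (fun x : E × (E →L[ℝ] ℝ) ↦ flatChristoffel B x.1)
      ((fderiv ℝ (flatChristoffel B) z.1).comp (ContinuousLinearMap.fst ℝ _ _)) z :=
      hΓ.hasFDerivAt.comp z hasFDerivAt_fst
    have h3 := ((hasFDerivAt_const Y.2 z).sub (hasFDerivAt_snd.clm_comp
      (h2.clm_apply (hasFDerivAt_const Y.1 z))))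
    have h4 := DFunLike.congr_fun (h1.unique h3) X
    simp at h4
    rw [hD, h4]
    abel
  -- From J Y = (-Y₁, 2 V Y - Y₂), only the derivative of V contributes.
  have hDJ : ∀ X Y, fderiv ℝ (modelJ B) z X Y = (0, (2 : ℝ) • D X Y) := by
    intro X Y
    have h1 := hJ.hasFDerivAt.clm_apply (hasFDerivAt_const Y z)
    have h2 := hV.hasFDerivAt.clm_apply (hasFDerivAt_const Y z)
    have h3 := (hasFDerivAt_const (-Y.1) z).prodMk ((h2.const_smul (2 : ℝ)).sub_const Y.2)
    have h4 := DFunLike.congr_fun (h1.unique (h3.congr_of_eventuallyEq (.of_forall fun x ↦ ?_))) X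
    · simpa using h4
    · simp only [modelJ_apply, modelVertical_apply, two_smul]
      refine Prod.ext rfl ?_
      simp
      abel
  have hDG : ∀ X Y Z, fderiv ℝ (modelMetric B φ) z X Y Z
      = (fderiv ℝ φ z.1 X.1 * B z.1 Y.1 Z.1 + φ z.1 * fderiv ℝ B z.1 X.1 Y.1 Z.1)
      + (fderiv ℝ (modelFiberMetric B) z X (modelVertical B z Y) (modelVertical B z Z)
      + modelFiberMetric B z (D X Y) (modelVertical B z Z)
      + modelFiberMetric B z (modelVertical B z Y) (D X Z)) := by
    intro X Y Z
    have h1 := hasFDerivAt_clm_apply_apply hG Y Z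
    have hY := hV.hasFDerivAt.clm_apply (hasFDerivAt_const Y z)
    have hZ := hV.hasFDerivAt.clm_apply (hasFDerivAt_const Z z)
    have h2 : HasFDerivAt (fun x : E × (E →L[ℝ] ℝ) ↦ B x.1 Y.1 Z.1) _ z :=
      (hasFDerivAt_clm_apply_apply (hB.differentiableAt (by simp)) Y.1 Z.1).comp z hasFDerivAt_fst
    have h3 : HasFDerivAt (fun x : E × (E →L[ℝ] ℝ) ↦ φ x.1) _ z :=
      ((hφ.differentiableAt (by simp)).hasFDerivAt).comp z hasFDerivAt_fst
    have h4 := (h3.mul h2).add ((ha.hasFDerivAt.clm_apply hY).clm_apply hZ)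
    have h5 := DFunLike.congr_fun (h1.unique h4) X
    simp at h5
    rw [h5, ← hD]
    ring
  have hV0 : ∀ η : E →L[ℝ] ℝ, modelVertical B z (0, η) = η := by
    intro η
    simp [modelVertical_apply]
  -- D X Y depends on Y only through its base component, which J negates.
  have hDA : ∀ X Y, D X (modelJ B z Y) = -D X Y := by
    intro X Y
    rw [hDX, hDX, modelJ_apply]
    ext w
    simp
    ring
  -- J is the identity minus twice the horizontal projection.
  have hAX : modelJ B z X = X - (2 : ℝ) • (X.1, z.2.comp (flatChristoffel B z.1 X.1)) := by
    rw [modelJ_apply, modelVertical_apply]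
    refine Prod.ext ?_ ?_
    · simp [two_smul]
    · simp [two_smul]; abel
  -- By `hAX` the first two terms amount to minus the derivative of V along the horizontal part of
  -- X. With the other two, the ∂Γ terms and the quadratic ΓΓ terms assemble into ξ∘R, and the fibre
  -- component of Y drops out.
  have hR : ∀ Y, z.2.comp (flatCurvature B z.1 X.1 Y.1)
      = (1 / 2 : ℝ) • D (modelJ B z X) Y - (1 / 2 : ℝ) • D X Y + D Y X
        + (modelVertical B z Y).comp (flatChristoffel B z.1 X.1) := by
    intro Y
    rw [hDX, hDX, hDX, modelJ_apply, modelVertical_apply, modelVertical_apply]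
    ext w
    simp [flatCurvature]
    ring
  rw [hR, hR]
  unfold tachibana
  rw [hDG, hDG, hDJ, hDJ, hDJ, modelVertical_modelJ, hDA, modelMetric_apply, modelMetric_apply,
    modelMetric_apply, hV0, hV0, hV0]
  -- The derivatives of the fibre metric along JX and along X differ by minus twice the one along
  -- the horizontal part of X, which parallelism of the fibre metric evaluates.
  have h1 : fderiv ℝ (modelFiberMetric B) z (modelJ B z X) (modelVertical B z Y)
      (modelVertical B z Z) = fderiv ℝ (modelFiberMetric B) z X (modelVertical B z Y)
      (modelVertical B z Z) - 2 * (-modelFiberMetric B z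
        ((modelVertical B z Y).comp (flatChristoffel B z.1 X.1)) (modelVertical B z Z)
        - modelFiberMetric B z (modelVertical B z Y)
          ((modelVertical B z Z).comp (flatChristoffel B z.1 X.1))) := by
    rw [← fderiv_modelFiberMetric_horizontal hB hi hp hs hinv, hAX, map_sub, map_smul]
    rfl
  rw [h1]
  -- This sign removes φ and B: differentiating along JX and inserting JY in the derivative along X
  -- both change the sign of the horizontal terms, whose difference then vanishes.
  have h2 : ∀ Y, (modelJ B z Y).1 = -Y.1 := fun Y ↦ by rw [modelJ_apply]
  rw [h2, h2]
  simp only [map_add, map_sub, map_neg, map_smul, add_apply, sub_apply, neg_apply, smul_apply,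
    smul_eq_mul, map_zero, zero_apply]
  ring

end FlatCalculus

/-! ### Chart components of tensor fields on a manifold -/

section Chart

variable {E : Type*} [NormedAddCommGroup E] [NormedSpace ℝ E]
  {H : Type*} [TopologicalSpace H] {I : ModelWithCorners ℝ E H}
  {N : Type*} [TopologicalSpace N] [ChartedSpace H N] [IsManifold I ∞ N]

variable (I) in
/-- The components, in the chart around `x₀`, of a vector field. -/
def fieldInChart (X : ∀ x : N, TangentSpace I x) (x₀ : N) (y : E) : E :=
  (trivializationAt E (TangentSpace I) x₀).continuousLinearMapAt ℝ ((extChartAt I x₀).symm y)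
    (X ((extChartAt I x₀).symm y))

theorem extChartAt_symm_mem_baseSet {x₀ : N} {y : E} (hy : y ∈ (extChartAt I x₀).target) :
    (extChartAt I x₀).symm y ∈ (trivializationAt E (TangentSpace I) x₀).baseSet := by
  have := (extChartAt I x₀).map_target hy
  rwa [extChartAt_source] at this

theorem symmL_fieldInChart (X : ∀ x : N, TangentSpace I x) {x₀ : N} {y : E}
    (hy : y ∈ (extChartAt I x₀).target) :
    (trivializationAt E (TangentSpace I) x₀).symmL ℝ ((extChartAt I x₀).symm y)
      (fieldInChart I X x₀ y) = X ((extChartAt I x₀).symm y) :=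
  Bundle.Trivialization.symmL_continuousLinearMapAt _ (extChartAt_symm_mem_baseSet hy) _

theorem bilinInChart_fieldInChart
    (g : ∀ x : N, TangentSpace I x →L[ℝ] TangentSpace I x →L[ℝ] ℝ)
    (Y Z : ∀ x : N, TangentSpace I x) {x₀ : N} {y : E} (hy : y ∈ (extChartAt I x₀).target) :
    bilinInChart I g x₀ y (fieldInChart I Y x₀ y) (fieldInChart I Z x₀ y)
      = g ((extChartAt I x₀).symm y) (Y ((extChartAt I x₀).symm y))
          (Z ((extChartAt I x₀).symm y)) := by
  rw [← symmL_fieldInChart Y hy, ← symmL_fieldInChart Z hy]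
  rfl

theorem endoInChart_fieldInChart (F : ∀ x : N, TangentSpace I x →L[ℝ] TangentSpace I x)
    (X : ∀ x : N, TangentSpace I x) {x₀ : N} {y : E} (hy : y ∈ (extChartAt I x₀).target) :
    endoInChart I F x₀ y (fieldInChart I X x₀ y) = fieldInChart I (fun z ↦ F z (X z)) x₀ y := by
  change (trivializationAt E (TangentSpace I) x₀).continuousLinearMapAt ℝ _ _ =
    (trivializationAt E (TangentSpace I) x₀).continuousLinearMapAt ℝ _ _
  exact congrArg (fun v ↦ (trivializationAt E (TangentSpace I) x₀).continuousLinearMapAt ℝ _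
    (F ((extChartAt I x₀).symm y) v)) (symmL_fieldInChart X hy)

/-- The tangent space at x is identified with E through the chart around x, so the derivative of
that chart at its own centre is the identity. -/
theorem continuousLinearMapAt_self (x : N) (v : TangentSpace I x) :
    (trivializationAt E (TangentSpace I) x).continuousLinearMapAt ℝ x v = v := by
  rw [TangentBundle.continuousLinearMapAt_trivializationAt (by simp), mfderiv_extChartAt_self]
  rfl

theorem symmL_self (x : N) (v : E) :
    (trivializationAt E (TangentSpace I) x).symmL ℝ x v = v := by
  rw [TangentBundle.symmL_trivializationAt (by simp), mfderivWithin_range_extChartAt_symm]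
  rfl

theorem fieldInChart_self (X : ∀ x : N, TangentSpace I x) (x : N) :
    fieldInChart I X x (extChartAt I x x) = X x := by
  have h : (extChartAt I x).symm (extChartAt I x x) = x := extChartAt_to_inv x
  unfold fieldInChart
  rw [h]
  exact continuousLinearMapAt_self x (X x)

theorem bilinInChart_self (g : ∀ x : N, TangentSpace I x →L[ℝ] TangentSpace I x →L[ℝ] ℝ) (x : N)
    (v w : TangentSpace I x) : bilinInChart I g x (extChartAt I x x) v w = g x v w := by
  have h : (extChartAt I x).symm (extChartAt I x x) = x := extChartAt_to_inv x
  unfold bilinInChart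
  rw [h]
  exact congrArg₂ (fun a b : TangentSpace I x ↦ g x a b) (symmL_self (I := I) (E := E) x v) (symmL_self (I := I) (E := E) x w)

theorem endoInChart_self (F : ∀ x : N, TangentSpace I x →L[ℝ] TangentSpace I x) (x : N)
    (v : TangentSpace I x) : endoInChart I F x (extChartAt I x x) v = F x v := by
  have h : (extChartAt I x).symm (extChartAt I x x) = x := extChartAt_to_inv x
  unfold endoInChart
  rw [h]
  exact (continuousLinearMapAt_self x _).trans
    (congrArg (fun a : TangentSpace I x ↦ F x a) (symmL_self (I := I) (E := E) x v))

variable [I.Boundaryless]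

omit [IsManifold I ∞ N] in
theorem eventually_mem_extChartAt_target (x : N) :
    ∀ᶠ y in 𝓝 (extChartAt I x x), y ∈ (extChartAt I x).target :=
  (isOpen_extChartAt_target x).mem_nhds (mem_extChartAt_target x)

theorem contDiffAt_of_contMDiffAt_chart {F : Type*} [NormedAddCommGroup F] [NormedSpace ℝ F]
    {f : N → F} {x₀ : N} {y : E} (hy : y ∈ (extChartAt I x₀).target)
    (hf : ContMDiffAt I 𝓘(ℝ, F) ∞ f ((extChartAt I x₀).symm y)) :
    ContDiffAt ℝ ∞ (fun z ↦ f ((extChartAt I x₀).symm z)) y := by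
  have h1 : ContMDiffAt 𝓘(ℝ, E) I ∞ (extChartAt I x₀).symm y :=
    (contMDiffOn_extChartAt_symm (n := ∞) x₀).contMDiffAt
      ((isOpen_extChartAt_target x₀).mem_nhds hy)
  exact (ContMDiffAt.comp y hf h1).contDiffAt

theorem contDiffAt_fieldInChart {X : ∀ x : N, TangentSpace I x}
    (hX : ContMDiff I I.tangent ∞ (fun x ↦ (⟨x, X x⟩ : TangentBundle I N))) (x₀ : N)
    {y : E} (hy : y ∈ (extChartAt I x₀).target) :
    ContDiffAt ℝ ∞ (fieldInChart I X x₀) y := by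
  have hb := extChartAt_symm_mem_baseSet hy
  have h1 := ((trivializationAt E (TangentSpace I) x₀).contMDiffAt_section_iff (IB := I) (n := ∞) hb).1
    (hX ((extChartAt I x₀).symm y))
  refine (contDiffAt_of_contMDiffAt_chart hy h1).congr_of_eventuallyEq ?_
  filter_upwards [(isOpen_extChartAt_target x₀).mem_nhds hy] with z hz
  rw [fieldInChart, Bundle.Trivialization.continuousLinearMapAt_apply,
    Bundle.Trivialization.coe_linearMapAt_of_mem _ (extChartAt_symm_mem_baseSet hz)]

omit [IsManifold I ∞ N] [I.Boundaryless] in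
theorem dirDeriv_eq_fderiv [IsManifold I 1 N] {X : ∀ x : N, TangentSpace I x} {f : N → ℝ} {x : N} {f' : E → ℝ}
    (hf : ∀ᶠ y in 𝓝 (extChartAt I x x), f ((extChartAt I x).symm y) = f' y)
    (hf' : DifferentiableAt ℝ f' (extChartAt I x x)) :
    dirDeriv I X f x = fderiv ℝ f' (extChartAt I x x) (X x) := by
  have h1 : HasMFDerivAt I 𝓘(ℝ, ℝ) (f' ∘ extChartAt I x) x _ :=
    hf'.hasFDerivAt.hasMFDerivAt.comp x (mdifferentiableAt_extChartAt (by simp)).hasMFDerivAt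
  have h2 : f =ᶠ[𝓝 x] f' ∘ extChartAt I x := by
    filter_upwards [(continuousAt_extChartAt x).eventually hf, extChartAt_source_mem_nhds (I := I) x]
      with z hz hz'
    rw [(extChartAt I x).left_inv hz'] at hz
    exact hz
  have h3 := (h1.congr_of_eventuallyEq h2).mfderiv
  rw [mfderiv_extChartAt_self] at h3
  exact DFunLike.congr_fun h3 (X x)

/-- The bracket on the manifold is the bracket of the pullbacks to the chart; near the centre those
pullbacks are the component fields, and at the centre the identification with E is trivial. -/
theorem mlieBracket_eq_fieldInChart [CompleteSpace E] (X Y : ∀ x : N, TangentSpace I x) (x : N) :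
    VectorField.mlieBracket I X Y x
      = fderiv ℝ (fieldInChart I Y x) (extChartAt I x x) (X x)
        - fderiv ℝ (fieldInChart I X x) (extChartAt I x x) (Y x) := by
  have h : ∀ X : (∀ x : N, TangentSpace I x), VectorField.mpullbackWithin 𝓘(ℝ, E) I
      (extChartAt I x).symm X (Set.range I) =ᶠ[𝓝 (extChartAt I x x)] fieldInChart I X x := by
    intro X
    filter_upwards [eventually_mem_extChartAt_target x] with y hy
    rw [VectorField.mpullbackWithin_apply]
    refine (isInvertible_mfderivWithin_extChartAt_symm hy).inverse_apply_eq.2 ?_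
    have h1 := symmL_fieldInChart X hy
    rw [TangentBundle.symmL_trivializationAt (extChartAt_symm_mem_baseSet hy),
      (extChartAt I x).right_inv hy] at h1
    exact h1.symm
  have hinv : ∀ w : E, (mfderiv I 𝓘(ℝ, E) (extChartAt I x) x).inverse w = w := by
    intro w
    rw [mfderiv_extChartAt_self]
    exact DFunLike.congr_fun (ContinuousLinearMap.inverse_id (R := ℝ) (M := E)) w
  rw [← VectorField.mlieBracketWithin_univ, VectorField.mlieBracketWithin_apply]
  refine (hinv _).trans ?_
  have hu : (extChartAt I x).symm ⁻¹' Set.univ ∩ Set.range I = Set.univ := by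
    rw [I.range_eq_univ, Set.preimage_univ, Set.univ_inter]
  rw [hu]
  refine ((h X).lieBracketWithin_vectorField_eq_nhds (h Y)).trans ?_
  rw [VectorField.lieBracketWithin_univ]
  have e1 : fieldInChart I X x (extChartAt I x x) = X x := fieldInChart_self X x
  have e2 : fieldInChart I Y x (extChartAt I x x) = Y x := fieldInChart_self Y x
  unfold VectorField.lieBracket
  exact congrArg₂ (fun a b : E ↦ fderiv ℝ (fieldInChart I Y x) (extChartAt I x x) a
        - fderiv ℝ (fieldInChart I X x) (extChartAt I x x) b) e1 e2

/-- Tensoriality of Φ: by the product rule all derivatives of X, Y and Z cancel. Only the derivative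
of Z along X needs purity, which matches G(AY, ∂_X Z) with G(Y, A ∂_X Z). -/
theorem tachibana_fields {A : E → E →L[ℝ] E} {G : E → E →L[ℝ] E →L[ℝ] ℝ} {X Y Z : E → E} {y : E}
    (hA : DifferentiableAt ℝ A y) (hG : DifferentiableAt ℝ G y) (hX : DifferentiableAt ℝ X y)
    (hY : DifferentiableAt ℝ Y y) (hZ : DifferentiableAt ℝ Z y)
    (hp : ∀ v w, G y (A y v) w = G y v (A y w)) :
    fderiv ℝ (fun z ↦ G z (Y z) (Z z)) y (A y (X y))
      - fderiv ℝ (fun z ↦ G z (A z (Y z)) (Z z)) y (X y)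
      + G y (fderiv ℝ (fun z ↦ A z (X z)) y (Y y) - fderiv ℝ Y y (A y (X y))
          - A y (fderiv ℝ X y (Y y) - fderiv ℝ Y y (X y))) (Z y)
      + G y (Y y) (fderiv ℝ (fun z ↦ A z (X z)) y (Z y) - fderiv ℝ Z y (A y (X y))
          - A y (fderiv ℝ X y (Z y) - fderiv ℝ Z y (X y)))
      = tachibana A G y (X y) (Y y) (Z y) := by
  have hAX := hA.hasFDerivAt.clm_apply hX.hasFDerivAt
  have hAY := hA.hasFDerivAt.clm_apply hY.hasFDerivAt
  have h1 := (hG.hasFDerivAt.clm_apply hY.hasFDerivAt).clm_apply hZ.hasFDerivAt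
  have h2 := (hG.hasFDerivAt.clm_apply hAY).clm_apply hZ.hasFDerivAt
  rw [hAX.fderiv, h1.fderiv, h2.fderiv, tachibana]
  simp only [add_apply, ContinuousLinearMap.comp_apply, ContinuousLinearMap.flip_apply, map_add,
    map_sub, sub_apply]
  linarith [hp (Y y) (fderiv ℝ Z y (X y))]

theorem phiOperator_eq_tachibana [CompleteSpace E]
    {F : ∀ x : N, TangentSpace I x →L[ℝ] TangentSpace I x}
    {g : ∀ x : N, TangentSpace I x →L[ℝ] TangentSpace I x →L[ℝ] ℝ} {x : N}
    (hF : DifferentiableAt ℝ (endoInChart I F x) (extChartAt I x x))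
    (hg : DifferentiableAt ℝ (bilinInChart I g x) (extChartAt I x x))
    (hp : ∀ v w, g x (F x v) w = g x v (F x w)) {X Y Z : ∀ x : N, TangentSpace I x}
    (hX : ContMDiff I I.tangent ∞ (fun x ↦ (⟨x, X x⟩ : TangentBundle I N)))
    (hY : ContMDiff I I.tangent ∞ (fun x ↦ (⟨x, Y x⟩ : TangentBundle I N)))
    (hZ : ContMDiff I I.tangent ∞ (fun x ↦ (⟨x, Z x⟩ : TangentBundle I N))) :
    phiOperator I F g X Y Z x
      = tachibana (endoInChart I F x) (bilinInChart I g x) (extChartAt I x x) (X x) (Y x) (Z x) := by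
  have hmem := mem_extChartAt_target (I := I) x
  set y := extChartAt I x x with hy
  have dX := (contDiffAt_fieldInChart hX x hmem).differentiableAt (by simp)
  have dY := (contDiffAt_fieldInChart hY x hmem).differentiableAt (by simp)
  have dZ := (contDiffAt_fieldInChart hZ x hmem).differentiableAt (by simp)
  have eX : fieldInChart I X x y = X x := fieldInChart_self X x
  have eY : fieldInChart I Y x y = Y x := fieldInChart_self Y x
  have eZ : fieldInChart I Z x y = Z x := fieldInChart_self Z x
  have eFX : endoInChart I F x y (fieldInChart I X x y) = F x (X x) :=
    (congrArg (endoInChart I F x y) eX).trans (endoInChart_self F x (X x))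
  have p : ∀ v w, bilinInChart I g x y (endoInChart I F x y v) w
      = bilinInChart I g x y v (endoInChart I F x y w) := by
    intro v w
    have h1 := endoInChart_self F x v
    have h2 := endoInChart_self F x w
    have h3 := bilinInChart_self g x (F x v) w
    have h4 := bilinInChart_self g x v (F x w)
    calc _ = bilinInChart I g x y (F x v) w := congrArg (fun a ↦ bilinInChart I g x y a w) h1
      _ = _ := h3.trans ((hp v w).trans h4.symm)
      _ = _ := (congrArg (fun a ↦ bilinInChart I g x y v a) h2).symm
  have hFX : fieldInChart I (fun z ↦ F z (X z)) x
      =ᶠ[𝓝 y] fun z ↦ endoInChart I F x z (fieldInChart I X x z) :=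
    (eventually_mem_extChartAt_target x).mono fun z hz ↦ (endoInChart_fieldInChart F X hz).symm
  have t1 : dirDeriv I (fun z ↦ F z (X z)) (fun z ↦ g z (Y z) (Z z)) x
      = fderiv ℝ (fun z ↦ bilinInChart I g x z (fieldInChart I Y x z) (fieldInChart I Z x z)) y
        (endoInChart I F x y (fieldInChart I X x y)) := by
    refine (dirDeriv_eq_fderiv ((eventually_mem_extChartAt_target x).mono fun z hz ↦
      (bilinInChart_fieldInChart g Y Z hz).symm) ((hg.clm_apply dY).clm_apply dZ)).trans ?_
    exact congrArg _ eFX.symm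
  have t2 : dirDeriv I X (fun z ↦ g z (F z (Y z)) (Z z)) x
      = fderiv ℝ (fun z ↦ bilinInChart I g x z (endoInChart I F x z (fieldInChart I Y x z))
        (fieldInChart I Z x z)) y (fieldInChart I X x y) := by
    refine (dirDeriv_eq_fderiv ((eventually_mem_extChartAt_target x).mono fun z hz ↦ ?_)
      ((hg.clm_apply (hF.clm_apply dY)).clm_apply dZ)).trans (congrArg _ eX.symm)
    rw [endoInChart_fieldInChart F Y hz]
    exact (bilinInChart_fieldInChart g (fun z ↦ F z (Y z)) Z hz).symm
  have t3 : ∀ W : (∀ x : N, TangentSpace I x), lieDerivEndo I W F X x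
      = fderiv ℝ (fun z ↦ endoInChart I F x z (fieldInChart I X x z)) y (fieldInChart I W x y)
        - fderiv ℝ (fieldInChart I W x) y (endoInChart I F x y (fieldInChart I X x y))
          - endoInChart I F x y (fderiv ℝ (fieldInChart I X x) y (fieldInChart I W x y)
            - fderiv ℝ (fieldInChart I W x) y (fieldInChart I X x y)) := by
    intro W
    have eW : fieldInChart I W x y = W x := fieldInChart_self W x
    have h1 := mlieBracket_eq_fieldInChart W (fun z ↦ F z (X z)) x
    have h2 := mlieBracket_eq_fieldInChart W X x
    have h3 : fderiv ℝ (fieldInChart I (fun z ↦ F z (X z)) x) (extChartAt I x x)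
        = fderiv ℝ (fun z ↦ endoInChart I F x z (fieldInChart I X x z)) y := hFX.fderiv_eq
    have h4 := endoInChart_self F x (VectorField.mlieBracket I W X x)
    rw [h3] at h1
    rw [eFX]
    rw [eX, eW]
    exact congrArg₂ (fun a b : E ↦ a - b) h1
      (h4.symm.trans (congrArg (endoInChart I F x y) h2))
  have t4 := bilinInChart_self g x (lieDerivEndo I Y F X x) (Z x)
  have t5 := bilinInChart_self g x (Y x) (lieDerivEndo I Z F X x)
  have key := tachibana_fields hF hg dX dY dZ p
  unfold phiOperator
  rw [t1, t2, ← t4, ← t5]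
  have u1 := congrArg₂ (fun a b : E ↦ bilinInChart I g x y a b) (t3 Y) eZ.symm
  have u2 := congrArg₂ (fun a b : E ↦ bilinInChart I g x y a b) eY.symm (t3 Z)
  rw [eX, eY, eZ] at key
  rw [eX, eY, eZ] at u1
  rw [eX, eY, eZ] at u2
  rw [eX]
  refine Eq.trans ?_ key
  exact congrArg₂ (· + ·) (congrArg₂ (· + ·) rfl u1) u2

-- A coordinate-constant field times a bump function centred at x is globally smooth and takes the
-- value v there. This recovers pointwise vanishing of the tensor Φ from a condition on global
-- fields.
omit [I.Boundaryless] in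
theorem exists_contMDiff_vectorField [FiniteDimensional ℝ E] [T2Space N] (x : N)
    (v : TangentSpace I x) : ∃ X : ∀ x : N, TangentSpace I x,
      ContMDiff I I.tangent ∞ (fun x ↦ (⟨x, X x⟩ : TangentBundle I N)) ∧ X x = v := by
  let e := trivializationAt E (TangentSpace I) x
  obtain ⟨ρ⟩ : Nonempty (SmoothBumpFunction I x) := inferInstance
  let w : E := v
  let s : ∀ z : N, TangentSpace I z := fun z ↦ e.symmL ℝ z w
  have hs : ContMDiffOn I I.tangent ∞ (fun z ↦ (⟨z, s z⟩ : TangentBundle I N))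
      (chartAt H x).source := by
    intro z hz
    refine ContMDiffAt.contMDiffWithinAt ((e.contMDiffAt_section_iff (IB := I) (n := ∞) hz).2 ?_)
    refine (contMDiffAt_const (c := w)).congr_of_eventuallyEq ?_
    filter_upwards [(chartAt H x).open_source.mem_nhds hz] with y hy
    have h : s y = e.symm y w := e.symmL_apply hy w
    exact (congrArg (fun v : TangentSpace I y ↦ (e ⟨y, v⟩).2) h).trans
      (congrArg Prod.snd (e.apply_mk_symm hy w))
  refine ⟨fun z ↦ ρ z • s z, ContMDiffOn.smul_section_of_tsupport
    (ρ.contMDiff.contMDiffOn) (chartAt H x).open_source ρ.tsupport_subset_chartAt_source hs, ?_⟩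
  have h1 : s x = v := symmL_self x w
  have h2 : ρ x • s x = s x := by rw [ρ.eq_one, one_smul]
  exact h2.trans h1

omit [I.Boundaryless] in
theorem contMDiff_endo_of_contDiffAt {F : ∀ x : N, TangentSpace I x →L[ℝ] TangentSpace I x}
    (hF : ∀ x, ContDiffAt ℝ ∞ (endoInChart I F x) (extChartAt I x x)) :
    ContMDiff I (I.prod 𝓘(ℝ, E →L[ℝ] E)) ∞
      (fun x : N ↦ Bundle.TotalSpace.mk' (E →L[ℝ] E)
        (E := fun x : N ↦ TangentSpace I x →L[ℝ] TangentSpace I x) x (F x)) := by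
  intro x
  rw [contMDiffAt_hom_bundle]
  refine ⟨contMDiffAt_id, ?_⟩
  have h1 : ContMDiffAt I 𝓘(ℝ, E →L[ℝ] E) ∞ (endoInChart I F x ∘ extChartAt I x) x :=
    (hF x).contMDiffAt.comp x contMDiffAt_extChartAt
  refine h1.congr_of_eventuallyEq ?_
  filter_upwards [extChartAt_source_mem_nhds (I := I) x] with z hz
  rw [Function.comp_apply]
  unfold endoInChart
  rw [(extChartAt I x).left_inv hz]
  rfl

omit [I.Boundaryless] in
theorem inCoordinates_eq_bilinInChart
    (g : ∀ x : N, TangentSpace I x →L[ℝ] TangentSpace I x →L[ℝ] ℝ) {x₀ z : N}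
    (hz : z ∈ (extChartAt I x₀).source) :
    ContinuousLinearMap.inCoordinates E (TangentSpace I) (E →L[ℝ] ℝ)
      (fun x : N ↦ TangentSpace I x →L[ℝ] ℝ) x₀ z x₀ z (g z)
      = bilinInChart I g x₀ (extChartAt I x₀ z) := by
  unfold bilinInChart
  rw [(extChartAt I x₀).left_inv hz]
  have hz' : z ∈ (trivializationAt E (TangentSpace I) x₀).baseSet := by
    rwa [extChartAt_source] at hz
  ext v w
  refine (inCoordinates_apply_eq₂ (E₃ := Bundle.Trivial N ℝ) hz' hz' (Set.mem_univ _)).trans ?_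
  have h1 : ∀ a : ℝ, (trivializationAt ℝ (Bundle.Trivial N ℝ) x₀).linearMapAt ℝ z a = a := by
    intro a
    exact DFunLike.congr_fun (Bundle.Trivial.linearMapAt_trivialization ℝ N ℝ z) a
  refine (h1 _).trans ?_
  exact congrArg₂ (fun a b ↦ g z a b) (Bundle.Trivialization.symmL_apply _ hz' v).symm
    (Bundle.Trivialization.symmL_apply _ hz' w).symm

omit [I.Boundaryless] in
theorem contMDiff_bilin_of_contDiffAt
    {g : ∀ x : N, TangentSpace I x →L[ℝ] TangentSpace I x →L[ℝ] ℝ}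
    (hg : ∀ x, ContDiffAt ℝ ∞ (bilinInChart I g x) (extChartAt I x x)) :
    ContMDiff I (I.prod 𝓘(ℝ, E →L[ℝ] E →L[ℝ] ℝ)) ∞
      (fun x : N ↦ Bundle.TotalSpace.mk' (E →L[ℝ] E →L[ℝ] ℝ)
        (E := fun x : N ↦ TangentSpace I x →L[ℝ] TangentSpace I x →L[ℝ] ℝ) x (g x)) := by
  intro x
  rw [contMDiffAt_hom_bundle]
  refine ⟨contMDiffAt_id, ?_⟩
  have h1 : ContMDiffAt I 𝓘(ℝ, E →L[ℝ] E →L[ℝ] ℝ) ∞ (bilinInChart I g x ∘ extChartAt I x) x :=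
    (hg x).contMDiffAt.comp x contMDiffAt_extChartAt
  refine h1.congr_of_eventuallyEq ?_
  filter_upwards [extChartAt_source_mem_nhds (I := I) x] with z hz
  exact inCoordinates_eq_bilinInChart g hz

theorem contDiffAt_bilinInChart
    {g : ∀ x : N, TangentSpace I x →L[ℝ] TangentSpace I x →L[ℝ] ℝ}
    (hg : ContMDiff I (I.prod 𝓘(ℝ, E →L[ℝ] E →L[ℝ] ℝ)) ∞
      (fun x : N ↦ Bundle.TotalSpace.mk' (E →L[ℝ] E →L[ℝ] ℝ)
        (E := fun x : N ↦ TangentSpace I x →L[ℝ] TangentSpace I x →L[ℝ] ℝ) x (g x)))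
    {x₀ : N} {y : E} (hy : y ∈ (extChartAt I x₀).target) :
    ContDiffAt ℝ ∞ (bilinInChart I g x₀) y := by
  have hb := extChartAt_symm_mem_baseSet hy
  have h1 := ((trivializationAt (E →L[ℝ] E →L[ℝ] ℝ)
    (fun x : N ↦ TangentSpace I x →L[ℝ] TangentSpace I x →L[ℝ] ℝ) x₀).contMDiffAt_section_iff
      (IB := I) (n := ∞) ⟨hb, hb, Set.mem_univ _⟩).1 (hg ((extChartAt I x₀).symm y))
  refine (contDiffAt_of_contMDiffAt_chart hy h1).congr_of_eventuallyEq ?_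
  filter_upwards [(isOpen_extChartAt_target x₀).mem_nhds hy] with z hz
  have h2 := inCoordinates_eq_bilinInChart g ((extChartAt I x₀).map_target hz)
  rw [(extChartAt I x₀).right_inv hz] at h2
  exact h2.symm

/-- The minimum c of T(v, v) on the compact unit sphere is positive, whence c‖v‖² ≤ T(v, v).
Boundedness of the unit ball is one of the axioms of a Riemannian metric on a bundle. -/
theorem isVonNBounded_of_pos [FiniteDimensional ℝ E] {T : E →L[ℝ] E →L[ℝ] ℝ}
    (hT : ∀ v, v ≠ 0 → 0 < T v v) : Bornology.IsVonNBounded ℝ {v : E | T v v < 1} := by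
  rw [NormedSpace.isVonNBounded_iff]
  obtain ⟨c, hc, h⟩ : ∃ c > 0, ∀ v, c * ‖v‖ ^ 2 ≤ T v v := by
    rcases subsingleton_or_nontrivial E with hE | hE
    · exact ⟨1, one_pos, fun v ↦ by simp [Subsingleton.elim v 0]⟩
    have hcont : Continuous fun v ↦ T v v := by fun_prop
    have := FiniteDimensional.proper ℝ E
    obtain ⟨v₀, hv₀, hmin⟩ := (isCompact_sphere (0 : E) 1).exists_isMinOn
      (NormedSpace.sphere_nonempty.2 zero_le_one) hcont.continuousOn
    have hne : v₀ ≠ 0 := by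
      rintro rfl
      simp at hv₀
    refine ⟨T v₀ v₀, hT v₀ hne, fun v ↦ ?_⟩
    rcases eq_or_ne v 0 with rfl | hv
    · simp
    have hn : ‖v‖ ≠ 0 := norm_ne_zero_iff.2 hv
    have h1 : T v₀ v₀ ≤ T (‖v‖⁻¹ • v) (‖v‖⁻¹ • v) :=
      hmin (show ‖v‖⁻¹ • v ∈ Metric.sphere (0 : E) 1 by simp [norm_smul, hn])
    simp only [map_smul, smul_apply, smul_eq_mul] at h1
    calc T v₀ v₀ * ‖v‖ ^ 2 ≤ (‖v‖⁻¹ * (‖v‖⁻¹ * T v v)) * ‖v‖ ^ 2 := by gcongr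
      _ = T v v := by field_simp
  refine (Metric.isBounded_closedBall (x := (0 : E)) (r := √(1 / c))).subset fun v hv ↦ ?_
  rw [mem_closedBall_zero_iff]
  refine Real.le_sqrt_of_sq_le ?_
  rw [le_div_iff₀ hc, mul_comm]
  exact (h v).trans (le_of_lt hv)

end Chart

/-- Points over different base points are separated in the base; points of one fibre lie in a common
trivialization. This makes bump functions available on T*M. -/
theorem Bundle.TotalSpace.t2Space {B F : Type*} {E : B → Type*} [TopologicalSpace B]
    [TopologicalSpace F] [TopologicalSpace (Bundle.TotalSpace F E)] [∀ b, TopologicalSpace (E b)]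
    [FiberBundle F E] [T2Space B] [T2Space F] : T2Space (Bundle.TotalSpace F E) := by
  refine ⟨fun p q hpq ↦ ?_⟩
  by_cases h : p.proj = q.proj
  · let e := trivializationAt F E p.proj
    have hp : p ∈ e.source := FiberBundle.mem_trivializationAt_proj_source
    have hq : q ∈ e.source := by
      rw [e.mem_source, ← h, ← e.mem_source]
      exact hp
    have hne : e p ≠ e q := fun he ↦ hpq (e.injOn hp hq he)
    obtain ⟨U, V, hU, hV, hpU, hqV, hd⟩ := t2_separation hne
    exact ⟨e.source ∩ e ⁻¹' U, e.source ∩ e ⁻¹' V,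
      e.toOpenPartialHomeomorph.isOpen_inter_preimage hU,
      e.toOpenPartialHomeomorph.isOpen_inter_preimage hV, ⟨hp, hpU⟩, ⟨hq, hqV⟩,
      (hd.preimage e).mono Set.inter_subset_right Set.inter_subset_right⟩
  · obtain ⟨U, V, hU, hV, hpU, hqV, hd⟩ := t2_separation h
    have hc := FiberBundle.continuous_proj F E
    exact ⟨_, _, hU.preimage hc, hV.preimage hc, hpU, hqV, hd.preimage _⟩


/-! ### Invariance of the model structures under coordinate changes -/

section ModelTransition

variable {E : Type*} [NormedAddCommGroup E] [NormedSpace ℝ E]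

theorem hasFDerivAt_cotangentTransition [CompleteSpace E] {τ : E → E} {y : E} {η : E →L[ℝ] ℝ}
    (hτ : ContDiffAt ℝ ∞ τ y) (hL : ∀ᶠ z in 𝓝 y, (fderiv ℝ τ z).IsInvertible)
    {σ : E × (E →L[ℝ] ℝ) → E × (E →L[ℝ] ℝ)}
    (hσ : ∀ᶠ z in 𝓝 (y, η), σ z = (τ z.1, z.2.comp (fderiv ℝ τ z.1).inverse))
    (X : E × (E →L[ℝ] ℝ)) :
    fderiv ℝ σ (y, η) X = (fderiv ℝ τ y X.1, X.2.comp (fderiv ℝ τ y).inverse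
      - η.comp ((fderiv ℝ τ y).inverse.comp
        ((fderiv ℝ (fderiv ℝ τ) y X.1).comp (fderiv ℝ τ y).inverse))) := by
  have hi := hL.self_of_nhds
  have hτ1 : HasFDerivAt τ (fderiv ℝ τ y) y := (hτ.differentiableAt (by simp)).hasFDerivAt
  have hD : ContDiffAt ℝ ∞ (fderiv ℝ τ) y := hτ.fderiv_right (m := ∞) (by simp)
  have hD1 : HasFDerivAt (fderiv ℝ τ) (fderiv ℝ (fderiv ℝ τ) y) y :=
    (hD.differentiableAt (by simp)).hasFDerivAt
  have hK : DifferentiableAt ℝ (fun z ↦ (fderiv ℝ τ z).inverse) y :=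
    (hi.contDiffAt_map_inverse.comp y hD : ContDiffAt ℝ ∞ _ y).differentiableAt (by simp)
  set K' := fderiv ℝ (fun z ↦ (fderiv ℝ τ z).inverse) y with hK'
  -- The derivative of an inverse, d(L⁻¹) = -L⁻¹ (dL) L⁻¹, obtained by differentiating L L⁻¹ = id.
  have e1 : ∀ u, K' u = -(fderiv ℝ τ y).inverse.comp
        ((fderiv ℝ (fderiv ℝ τ) y u).comp (fderiv ℝ τ y).inverse) := by
    intro u
    have h1 := hD1.clm_comp hK.hasFDerivAt
    have h2 : HasFDerivAt (fun z ↦ (fderiv ℝ τ z).comp (fderiv ℝ τ z).inverse)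
        (0 : E →L[ℝ] E →L[ℝ] E) y :=
      (hasFDerivAt_const (ContinuousLinearMap.id ℝ E) y).congr_of_eventuallyEq
        (hL.mono fun z hz ↦ ContinuousLinearMap.ext fun v ↦ hz.apply_inverse v)
    have h3 := DFunLike.congr_fun (h1.unique h2) u
    ext v
    have h4 := DFunLike.congr_fun h3 v
    simp at h4
    apply hi.injective
    simp only [neg_apply, ContinuousLinearMap.comp_apply, map_neg, hi.apply_inverse]
    rw [hK']
    exact eq_neg_of_add_eq_zero_left h4
  have hfst : HasFDerivAt (Prod.fst : E × (E →L[ℝ] ℝ) → E) _ (y, η) :=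
    hasFDerivAt_fst (𝕜 := ℝ)
  have h5 : HasFDerivAt (fun z : E × (E →L[ℝ] ℝ) ↦ τ z.1)
      ((fderiv ℝ τ y).comp (ContinuousLinearMap.fst ℝ _ _)) (y, η) :=
    HasFDerivAt.comp (g := τ) (y, η) hτ1 hfst
  have h6 : HasFDerivAt (fun z : E × (E →L[ℝ] ℝ) ↦ (fderiv ℝ τ z.1).inverse)
      (K'.comp (ContinuousLinearMap.fst ℝ _ _)) (y, η) :=
    HasFDerivAt.comp (g := fun z ↦ (fderiv ℝ τ z).inverse) (y, η) hK.hasFDerivAt hfst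
  have h7 := (h5.prodMk ((hasFDerivAt_snd (𝕜 := ℝ)).clm_comp h6)).congr_of_eventuallyEq hσ
  rw [h7.fderiv]
  refine Prod.ext rfl ?_
  simp [e1]
  abel

variable {B B₀ : E → E →L[ℝ] E →L[ℝ] ℝ} {τ : E → E} {y : E} {η : E →L[ℝ] ℝ}

/-- The d²τ term in the differential of the cotangent transition is exactly compensated by the
inhomogeneous term in the law for Γ, so the vertical part transforms like a covector. -/
theorem modelVertical_transition
    (hΓ : ∀ u v, fderiv ℝ τ y (flatChristoffel B₀ y u v)
      = flatChristoffel B (τ y) (fderiv ℝ τ y u) (fderiv ℝ τ y v)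
        + fderiv ℝ (fderiv ℝ τ) y u v) (hi : (fderiv ℝ τ y).IsInvertible)
    {S : E × (E →L[ℝ] ℝ) →L[ℝ] E × (E →L[ℝ] ℝ)}
    (hS : ∀ X, S X = (fderiv ℝ τ y X.1, X.2.comp (fderiv ℝ τ y).inverse
      - η.comp ((fderiv ℝ τ y).inverse.comp
        ((fderiv ℝ (fderiv ℝ τ) y X.1).comp (fderiv ℝ τ y).inverse))))
    (X : E × (E →L[ℝ] ℝ)) :
    modelVertical B (τ y, η.comp (fderiv ℝ τ y).inverse) (S X)
      = (modelVertical B₀ (y, η) X).comp (fderiv ℝ τ y).inverse := by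
  rw [modelVertical_apply, modelVertical_apply, hS]
  ext v
  have h := congrArg (fderiv ℝ τ y).inverse (hΓ X.1 ((fderiv ℝ τ y).inverse v))
  have h0 : ∀ w, (fderiv ℝ τ y).inverse (fderiv ℝ τ y w) = w := by
    intro w
    apply hi.injective
    rw [hi.apply_inverse]
  rw [h0, hi.apply_inverse, map_add] at h
  simp only [sub_apply, ContinuousLinearMap.comp_apply]
  rw [h, map_add]
  ring

/-- A vector is determined by its base component and vertical part. J negates the first and fixes
the second, and both are natural under S. -/
theorem modelJ_transition
    (hΓ : ∀ u v, fderiv ℝ τ y (flatChristoffel B₀ y u v)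
      = flatChristoffel B (τ y) (fderiv ℝ τ y u) (fderiv ℝ τ y v)
        + fderiv ℝ (fderiv ℝ τ) y u v) (hi : (fderiv ℝ τ y).IsInvertible)
    {S : E × (E →L[ℝ] ℝ) →L[ℝ] E × (E →L[ℝ] ℝ)}
    (hS : ∀ X, S X = (fderiv ℝ τ y X.1, X.2.comp (fderiv ℝ τ y).inverse
      - η.comp ((fderiv ℝ τ y).inverse.comp
        ((fderiv ℝ (fderiv ℝ τ) y X.1).comp (fderiv ℝ τ y).inverse))))
    (X : E × (E →L[ℝ] ℝ)) :
    modelJ B (τ y, η.comp (fderiv ℝ τ y).inverse) (S X) = S (modelJ B₀ (y, η) X) := by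
  have h1 : (modelJ B (τ y, η.comp (fderiv ℝ τ y).inverse) (S X)).1
      = (S (modelJ B₀ (y, η) X)).1 := by
    rw [hS, hS, modelJ_apply, modelJ_apply, map_neg]
  have h2 := modelVertical_transition hΓ hi hS (modelJ B₀ (y, η) X)
  rw [modelVertical_modelJ, ← modelVertical_transition hΓ hi hS] at h2
  have h3 := (modelVertical_modelJ (B := B) _ (S X)).trans h2.symm
  rw [modelVertical_apply, modelVertical_apply, h1] at h3
  exact Prod.ext h1 (sub_left_injective h3)

theorem modelMetric_transition {φ φ₀ : E → ℝ} (hφ : φ₀ y = φ (τ y))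
    (hB : ∀ v w, B₀ y v w = B (τ y) (fderiv ℝ τ y v) (fderiv ℝ τ y w))
    (hBi : (B (τ y)).IsInvertible) (hB₀i : (B₀ y).IsInvertible)
    (hΓ : ∀ u v, fderiv ℝ τ y (flatChristoffel B₀ y u v)
      = flatChristoffel B (τ y) (fderiv ℝ τ y u) (fderiv ℝ τ y v)
        + fderiv ℝ (fderiv ℝ τ) y u v) (hi : (fderiv ℝ τ y).IsInvertible)
    {S : E × (E →L[ℝ] ℝ) →L[ℝ] E × (E →L[ℝ] ℝ)}
    (hS : ∀ X, S X = (fderiv ℝ τ y X.1, X.2.comp (fderiv ℝ τ y).inverse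
      - η.comp ((fderiv ℝ τ y).inverse.comp
        ((fderiv ℝ (fderiv ℝ τ) y X.1).comp (fderiv ℝ τ y).inverse))))
    (X Y : E × (E →L[ℝ] ℝ)) :
    modelMetric B φ (τ y, η.comp (fderiv ℝ τ y).inverse) (S X) (S Y)
      = modelMetric B₀ φ₀ (y, η) X Y := by
  -- The cometric is natural because raising an index commutes with dτ, which is an isometry from B₀
  -- to B.
  have hC : ∀ ω' θ : E →L[ℝ] ℝ, flatCometric B (τ y) (ω'.comp (fderiv ℝ τ y).inverse)
      (θ.comp (fderiv ℝ τ y).inverse) = flatCometric B₀ y ω' θ := by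
    intro ω' θ
    rw [flatCometric_apply, flatCometric_apply, ContinuousLinearMap.comp_apply]
    congr 1
    apply hB₀i.injective
    ext v
    rw [hB, hi.apply_inverse, hBi.apply_inverse, hB₀i.apply_inverse, ContinuousLinearMap.comp_apply]
    congr 1
    apply hi.injective
    rw [hi.apply_inverse]
  rw [modelMetric_apply, modelMetric_apply, modelVertical_transition hΓ hi hS,
    modelVertical_transition hΓ hi hS, modelFiberMetric_apply, modelFiberMetric_apply]
  simp only [hC, hφ, hS, hB]

end ModelTransition

/-! ### Transition maps and coordinate frames of the tangent bundle -/

section ChartTransition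

variable {E : Type*} [NormedAddCommGroup E] [NormedSpace ℝ E]
  {H : Type*} [TopologicalSpace H] {I : ModelWithCorners ℝ E H} [I.Boundaryless]
  {N : Type*} [TopologicalSpace N] [ChartedSpace H N] [IsManifold I ∞ N]

theorem hasFDerivAt_transition {x₀ x : N} {y : E} (hy : y ∈ (extChartAt I x₀).target)
    (hx : (extChartAt I x₀).symm y ∈ (extChartAt I x).source) :
    HasFDerivAt (extChartAt I x ∘ (extChartAt I x₀).symm)
      (tangentCoordChange I x₀ x ((extChartAt I x₀).symm y)) y := by
  have h := hasFDerivWithinAt_tangentCoordChange (I := I)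
    ⟨(extChartAt I x₀).map_target hy, hx⟩
  rw [(extChartAt I x₀).right_inv hy, I.range_eq_univ] at h
  exact h.hasFDerivAt Filter.univ_mem

theorem contDiffAt_transition {x₀ x : N} {y : E} (hy : y ∈ (extChartAt I x₀).target)
    (hx : (extChartAt I x₀).symm y ∈ (extChartAt I x).source) :
    ContDiffAt ℝ ∞ (extChartAt I x ∘ (extChartAt I x₀).symm) y :=
  contDiffAt_of_contMDiffAt_chart hy (contMDiffAt_extChartAt' (by rwa [extChartAt_source] at hx))

omit [IsManifold I ∞ N] in
theorem eventually_transition {x₀ x : N} {y : E} (hy : y ∈ (extChartAt I x₀).target)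
    (hx : (extChartAt I x₀).symm y ∈ (extChartAt I x).source) :
    ∀ᶠ z in 𝓝 y, z ∈ (extChartAt I x₀).target ∧
      (extChartAt I x₀).symm z ∈ (extChartAt I x).source :=
  Filter.Eventually.and ((isOpen_extChartAt_target x₀).mem_nhds hy)
    ((continuousAt_extChartAt_symm'' hy).eventually ((isOpen_extChartAt_source x).mem_nhds hx))

omit [I.Boundaryless] in
theorem isInvertible_tangentCoordChange {x₀ x z : N} (hx₀ : z ∈ (extChartAt I x₀).source)
    (hx : z ∈ (extChartAt I x).source) :
    (tangentCoordChange I x₀ x z).IsInvertible := by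
  refine ContinuousLinearMap.IsInvertible.of_inverse (g := tangentCoordChange I x x₀ z) ?_ ?_
  · ext v
    exact (tangentCoordChange_comp ⟨⟨hx, hx₀⟩, hx⟩).trans (tangentCoordChange_self hx)
  · ext v
    exact (tangentCoordChange_comp ⟨⟨hx₀, hx⟩, hx₀⟩).trans (tangentCoordChange_self hx₀)

omit [I.Boundaryless] in
theorem tangentCoordChange_inverse {x₀ x z : N} (hx₀ : z ∈ (extChartAt I x₀).source)
    (hx : z ∈ (extChartAt I x).source) :
    (tangentCoordChange I x₀ x z).inverse = tangentCoordChange I x x₀ z := by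
  ext v
  apply (isInvertible_tangentCoordChange hx₀ hx).injective
  rw [(isInvertible_tangentCoordChange hx₀ hx).apply_inverse]
  exact ((tangentCoordChange_comp ⟨⟨hx, hx₀⟩, hx⟩).trans (tangentCoordChange_self hx)).symm

omit [I.Boundaryless] in
-- This is the cocycle identity for the tangent coordinate changes, read through the chart centred
-- at z.
theorem symmL_transition {x₀ x z : N} (hx₀ : z ∈ (extChartAt I x₀).source)
    (hx : z ∈ (extChartAt I x).source) (v : E) :
    (trivializationAt E (TangentSpace I) x₀).symmL ℝ z v
      = (trivializationAt E (TangentSpace I) x).symmL ℝ z (tangentCoordChange I x₀ x z v) := by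
  rw [TangentBundle.symmL_trivializationAt_eq_core (by rwa [extChartAt_source] at hx₀),
    TangentBundle.symmL_trivializationAt_eq_core (by rwa [extChartAt_source] at hx)]
  exact (tangentCoordChange_comp ⟨⟨hx₀, hx⟩, mem_extChartAt_source z⟩).symm

theorem symmL_eq_fderiv_transition {x₀ : N} {y : E} (hy : y ∈ (extChartAt I x₀).target) (v : E) :
    (trivializationAt E (TangentSpace I) x₀).symmL ℝ ((extChartAt I x₀).symm y) v
      = fderiv ℝ (extChartAt I ((extChartAt I x₀).symm y) ∘ (extChartAt I x₀).symm) y v := by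
  rw [(hasFDerivAt_transition hy (mem_extChartAt_source _)).fderiv,
    TangentBundle.symmL_trivializationAt_eq_core (extChartAt_symm_mem_baseSet hy)]
  rfl

theorem bilinInChart_transition (g : ∀ x : N, TangentSpace I x →L[ℝ] TangentSpace I x →L[ℝ] ℝ)
    {x₀ x : N} {y : E} (hy : y ∈ (extChartAt I x₀).target)
    (hx : (extChartAt I x₀).symm y ∈ (extChartAt I x).source) (v w : E) :
    bilinInChart I g x₀ y v w
      = bilinInChart I g x ((extChartAt I x ∘ (extChartAt I x₀).symm) y)
        (fderiv ℝ (extChartAt I x ∘ (extChartAt I x₀).symm) y v)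
        (fderiv ℝ (extChartAt I x ∘ (extChartAt I x₀).symm) y w) := by
  rw [(hasFDerivAt_transition hy hx).fderiv]
  have h0 : (extChartAt I x).symm ((extChartAt I x ∘ (extChartAt I x₀).symm) y)
    = (extChartAt I x₀).symm y := (extChartAt I x).left_inv hx
  unfold bilinInChart
  rw [h0]
  set z := (extChartAt I x₀).symm y
  have hx₀ : z ∈ (extChartAt I x₀).source := (extChartAt I x₀).map_target hy
  exact congrArg₂ (fun a b : TangentSpace I z ↦ g z a b) (symmL_transition hx₀ hx v)
    (symmL_transition hx₀ hx w)

end ChartTransition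

/-! ### Natural coordinates on T*M -/

section Cotangent

variable {E : Type*} [NormedAddCommGroup E] [NormedSpace ℝ E]
  {M : Type*} [TopologicalSpace M] [ChartedSpace E M] [IsManifold 𝓘(ℝ, E) ∞ M]

/-- The chart of the bundle of linear forms is the induced chart (xⁱ, pᵢ): a covector is recorded by
its values on the coordinate frame. -/
theorem extChartAt_cotangent_apply (p₀ p : CotangentBundle E M) :
    extChartAt (cotangentModel E) p₀ p = (extChartAt 𝓘(ℝ, E) p₀.proj p.proj,
      ContinuousLinearMap.comp (show E →L[ℝ] ℝ from p.snd)
        ((trivializationAt E (TangentSpace 𝓘(ℝ, E)) p₀.proj).symmL ℝ p.proj : E →L[ℝ] E)) := by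
  refine Prod.ext rfl ?_
  ext v
  exact DFunLike.congr_fun (Bundle.Trivial.linearMapAt_trivialization ℝ M ℝ p.proj) _

theorem extChartAt_cotangent_target (p₀ : CotangentBundle E M) :
    (extChartAt (cotangentModel E) p₀).target
      = (extChartAt 𝓘(ℝ, E) p₀.proj).target ×ˢ Set.univ := by
  rw [FiberBundle.extChartAt_target]
  congr 1
  refine Set.inter_eq_left.2 fun y hy ↦ ?_
  exact ⟨extChartAt_symm_mem_baseSet hy, Set.mem_univ _⟩

theorem proj_mem_source_of_mem_source {p₀ p : CotangentBundle E M}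
    (hp : p ∈ (extChartAt (cotangentModel E) p₀).source) :
    p.proj ∈ (extChartAt 𝓘(ℝ, E) p₀.proj).source := by
  rw [FiberBundle.extChartAt, PartialEquiv.trans_source] at hp
  rw [extChartAt_source]
  exact hp.1.1

theorem extChartAt_cotangent_symm_proj {p₀ : CotangentBundle E M} {z : E × (E →L[ℝ] ℝ)}
    (hz : z ∈ (extChartAt (cotangentModel E) p₀).target) :
    ((extChartAt (cotangentModel E) p₀).symm z).proj
      = (extChartAt 𝓘(ℝ, E) p₀.proj).symm z.1 := by
  have h1 := proj_mem_source_of_mem_source ((extChartAt (cotangentModel E) p₀).map_target hz)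
  have h2 := (extChartAt_cotangent_apply p₀ _).symm.trans
    ((extChartAt (cotangentModel E) p₀).right_inv hz)
  rw [← congrArg Prod.fst h2]
  exact ((extChartAt 𝓘(ℝ, E) p₀.proj).left_inv h1).symm

theorem extChartAt_cotangent_self (p : CotangentBundle E M) :
    extChartAt (cotangentModel E) p p = (extChartAt 𝓘(ℝ, E) p.proj p.proj, p.snd) := by
  rw [extChartAt_cotangent_apply]
  refine Prod.ext rfl ?_
  ext v
  exact congrArg (fun w : TangentSpace 𝓘(ℝ, E) p.proj ↦ p.snd w)
    (symmL_self (I := 𝓘(ℝ, E)) p.proj v)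

/-- Fibre coordinates transform by the inverse Jacobian, being values on a frame that transforms by
the Jacobian. -/
theorem cotangentTransition_apply {p₀ p : CotangentBundle E M} {z : E × (E →L[ℝ] ℝ)}
    (hz : z.1 ∈ (extChartAt 𝓘(ℝ, E) p₀.proj).target)
    (hp : (extChartAt 𝓘(ℝ, E) p₀.proj).symm z.1 ∈ (extChartAt 𝓘(ℝ, E) p.proj).source) :
    (extChartAt (cotangentModel E) p ∘ (extChartAt (cotangentModel E) p₀).symm) z
      = ((extChartAt 𝓘(ℝ, E) p.proj ∘ (extChartAt 𝓘(ℝ, E) p₀.proj).symm) z.1,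
        z.2.comp (fderiv ℝ
          (extChartAt 𝓘(ℝ, E) p.proj ∘ (extChartAt 𝓘(ℝ, E) p₀.proj).symm) z.1).inverse) := by
  have hz' : z ∈ (extChartAt (cotangentModel E) p₀).target := by
    rw [extChartAt_cotangent_target]
    exact ⟨hz, Set.mem_univ _⟩
  have h1 := extChartAt_cotangent_symm_proj hz'
  have h2 := (extChartAt_cotangent_apply p₀ _).symm.trans
    ((extChartAt (cotangentModel E) p₀).right_inv hz')
  have h3 := (extChartAt 𝓘(ℝ, E) p₀.proj).map_target hz
  rw [Function.comp_apply, extChartAt_cotangent_apply, (hasFDerivAt_transition hz hp).fderiv,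
    tangentCoordChange_inverse h3 hp]
  rw [← h1] at hp h3
  refine Prod.ext (congrArg (extChartAt 𝓘(ℝ, E) p.proj) h1) ?_
  rw [← congrArg Prod.snd h2, ← h1]
  ext v
  exact congrArg (fun w : TangentSpace 𝓘(ℝ, E) _ ↦
    ((extChartAt (cotangentModel E) p₀).symm z).snd w) (symmL_transition hp h3 v)

theorem cruceanuJ_eq_modelJ
    (g : Bundle.ContMDiffRiemannianMetric 𝓘(ℝ, E) ∞ E (fun x : M ↦ TangentSpace 𝓘(ℝ, E) x))
    (p : CotangentBundle E M) (X : E × (E →L[ℝ] ℝ)) :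
    cruceanuJ g p X = modelJ (bilinInChart 𝓘(ℝ, E) g.inner p.proj)
      (extChartAt 𝓘(ℝ, E) p.proj p.proj, p.snd) X := rfl

theorem cheegerGromollMetric_eq_modelMetric
    (g : Bundle.ContMDiffRiemannianMetric 𝓘(ℝ, E) ∞ E (fun x : M ↦ TangentSpace 𝓘(ℝ, E) x))
    (f : M → ℝ) (p : CotangentBundle E M) (X Y : E × (E →L[ℝ] ℝ)) :
    cheegerGromollMetric g f p X Y = modelMetric (bilinInChart 𝓘(ℝ, E) g.inner p.proj)
      (fun y ↦ f ((extChartAt 𝓘(ℝ, E) p.proj).symm y))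
      (extChartAt 𝓘(ℝ, E) p.proj p.proj, p.snd) X Y := by
  have h1 : bilinInChart 𝓘(ℝ, E) g.inner p.proj (extChartAt 𝓘(ℝ, E) p.proj p.proj)
      = g.inner p.proj := by
    ext v w
    exact bilinInChart_self g.inner p.proj v w
  have h2 : (extChartAt 𝓘(ℝ, E) p.proj).symm (extChartAt 𝓘(ℝ, E) p.proj p.proj) = p.proj :=
    extChartAt_to_inv _
  rw [modelMetric_apply, modelFiberMetric_apply, h1, h2]
  unfold flatCometric
  rw [h1]
  rfl

theorem bilinInChart_symm
    (g : Bundle.ContMDiffRiemannianMetric 𝓘(ℝ, E) ∞ E (fun x : M ↦ TangentSpace 𝓘(ℝ, E) x))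
    (x₀ : M) (y v w : E) :
    bilinInChart 𝓘(ℝ, E) g.inner x₀ y v w = bilinInChart 𝓘(ℝ, E) g.inner x₀ y w v :=
  g.symm ((extChartAt 𝓘(ℝ, E) x₀).symm y)
    ((trivializationAt E (TangentSpace 𝓘(ℝ, E)) x₀).symmL ℝ ((extChartAt 𝓘(ℝ, E) x₀).symm y) v)
    ((trivializationAt E (TangentSpace 𝓘(ℝ, E)) x₀).symmL ℝ ((extChartAt 𝓘(ℝ, E) x₀).symm y) w)

theorem bilinInChart_pos
    (g : Bundle.ContMDiffRiemannianMetric 𝓘(ℝ, E) ∞ E (fun x : M ↦ TangentSpace 𝓘(ℝ, E) x))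
    {x₀ : M} {y : E} (hy : y ∈ (extChartAt 𝓘(ℝ, E) x₀).target) (v : E) (hv : v ≠ 0) :
    0 < bilinInChart 𝓘(ℝ, E) g.inner x₀ y v v := by
  refine g.pos _ _ fun h ↦ hv ?_
  have h1 := (trivializationAt E (TangentSpace 𝓘(ℝ, E)) x₀).continuousLinearMapAt_symmL (R := ℝ)
    (extChartAt_symm_mem_baseSet hy) v
  rw [← h1]
  exact (congrArg ((trivializationAt E (TangentSpace 𝓘(ℝ, E)) x₀).continuousLinearMapAt ℝ
    ((extChartAt 𝓘(ℝ, E) x₀).symm y)) h).trans (map_zero _)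

theorem bilinInChart_isInvertible [FiniteDimensional ℝ E]
    (g : Bundle.ContMDiffRiemannianMetric 𝓘(ℝ, E) ∞ E (fun x : M ↦ TangentSpace 𝓘(ℝ, E) x))
    {x₀ : M} {y : E} (hy : y ∈ (extChartAt 𝓘(ℝ, E) x₀).target) :
    (bilinInChart 𝓘(ℝ, E) g.inner x₀ y).IsInvertible :=
  isInvertible_of_pos (bilinInChart_pos g hy)

theorem christoffel_transition [FiniteDimensional ℝ E]
    (g : Bundle.ContMDiffRiemannianMetric 𝓘(ℝ, E) ∞ E (fun x : M ↦ TangentSpace 𝓘(ℝ, E) x))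
    {x₀ x : M} {y : E} (hy : y ∈ (extChartAt 𝓘(ℝ, E) x₀).target)
    (hx : (extChartAt 𝓘(ℝ, E) x₀).symm y ∈ (extChartAt 𝓘(ℝ, E) x).source) (u v : E) :
    let τ := extChartAt 𝓘(ℝ, E) x ∘ (extChartAt 𝓘(ℝ, E) x₀).symm
    fderiv ℝ τ y (flatChristoffel (bilinInChart 𝓘(ℝ, E) g.inner x₀) y u v)
      = flatChristoffel (bilinInChart 𝓘(ℝ, E) g.inner x) (τ y) (fderiv ℝ τ y u) (fderiv ℝ τ y v)
        + fderiv ℝ (fderiv ℝ τ) y u v := by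
  intro τ
  have hτy : τ y ∈ (extChartAt 𝓘(ℝ, E) x).target := (extChartAt 𝓘(ℝ, E) x).map_source hx
  have hL := isInvertible_tangentCoordChange ((extChartAt 𝓘(ℝ, E) x₀).map_target hy) hx
  rw [← (hasFDerivAt_transition hy hx).fderiv] at hL
  refine flatChristoffel_pullback ((contDiffAt_transition hy hx).of_le (by norm_cast))
    ((contDiffAt_bilinInChart g.contMDiff hτy).differentiableAt (by simp))
    (.of_forall fun z ↦ bilinInChart_symm g x z) (bilinInChart_isInvertible g hτy)
    (bilinInChart_isInvertible g hy) (fun w ↦ ⟨_, hL.apply_inverse w⟩) ?_ u v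
  filter_upwards [eventually_transition hy hx] with z hz v w
  exact bilinInChart_transition g.inner hz.1 hz.2 v w

/-- Compares the chart around p₀ with the chart centred at a nearby p: the frame of the former at p
is the differential of the transition, and the transition sends z to the coordinates of p in its own
chart. -/
theorem symmL_cotangent [FiniteDimensional ℝ E] {p₀ : CotangentBundle E M} {z : E × (E →L[ℝ] ℝ)}
    (hz : z ∈ (extChartAt (cotangentModel E) p₀).target) :
    let p := (extChartAt (cotangentModel E) p₀).symm z
    let τ := extChartAt 𝓘(ℝ, E) p.proj ∘ (extChartAt 𝓘(ℝ, E) p₀.proj).symm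
    (∀ X : E × (E →L[ℝ] ℝ),
      ((trivializationAt (E × (E →L[ℝ] ℝ)) (TangentSpace (cotangentModel E)) p₀).symmL ℝ p X :
        E × (E →L[ℝ] ℝ)) = (fderiv ℝ τ z.1 X.1, X.2.comp (fderiv ℝ τ z.1).inverse
        - z.2.comp ((fderiv ℝ τ z.1).inverse.comp
          ((fderiv ℝ (fderiv ℝ τ) z.1 X.1).comp (fderiv ℝ τ z.1).inverse)))) ∧
    (extChartAt 𝓘(ℝ, E) p.proj p.proj, (p.snd : E →L[ℝ] ℝ))
      = (τ z.1, z.2.comp (fderiv ℝ τ z.1).inverse) := by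
  intro p τ
  have := FiniteDimensional.complete ℝ E
  have hy : z.1 ∈ (extChartAt 𝓘(ℝ, E) p₀.proj).target := by
    rw [extChartAt_cotangent_target] at hz
    exact hz.1
  have hp : p.proj = (extChartAt 𝓘(ℝ, E) p₀.proj).symm z.1 := extChartAt_cotangent_symm_proj hz
  have hx : (extChartAt 𝓘(ℝ, E) p₀.proj).symm z.1 ∈ (extChartAt 𝓘(ℝ, E) p.proj).source := by
    rw [← hp]
    exact mem_extChartAt_source p.proj
  constructor
  · intro X
    refine (symmL_eq_fderiv_transition hz X).trans ?_
    refine hasFDerivAt_cotangentTransition (contDiffAt_transition hy hx) ?_ ?_ X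
    · filter_upwards [eventually_transition hy hx] with y' hy'
      rw [(hasFDerivAt_transition hy'.1 hy'.2).fderiv]
      exact isInvertible_tangentCoordChange ((extChartAt 𝓘(ℝ, E) p₀.proj).map_target hy'.1) hy'.2
    · filter_upwards [continuousAt_fst.eventually (eventually_transition hy hx)] with z' hz'
      exact cotangentTransition_apply hz'.1 hz'.2
  · rw [← extChartAt_cotangent_self]
    exact cotangentTransition_apply hy hx

/-- J is prescribed at each point in the chart centred there. Invariance of the model lets a single
formula serve on the entire chart around p₀, so that it can be differentiated. -/
theorem endoInChart_cruceanuJ [FiniteDimensional ℝ E]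
    (g : Bundle.ContMDiffRiemannianMetric 𝓘(ℝ, E) ∞ E (fun x : M ↦ TangentSpace 𝓘(ℝ, E) x))
    (p₀ : CotangentBundle E M) {z : E × (E →L[ℝ] ℝ)}
    (hz : z ∈ (extChartAt (cotangentModel E) p₀).target) :
    endoInChart (cotangentModel E) (cruceanuJ g) p₀ z
      = modelJ (bilinInChart 𝓘(ℝ, E) g.inner p₀.proj) z := by
  obtain ⟨hS, hc⟩ := symmL_cotangent hz
  have hy : z.1 ∈ (extChartAt 𝓘(ℝ, E) p₀.proj).target := by
    rw [extChartAt_cotangent_target] at hz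
    exact hz.1
  have hp := extChartAt_cotangent_symm_proj hz
  set p := (extChartAt (cotangentModel E) p₀).symm z with hpdef
  have hx : (extChartAt 𝓘(ℝ, E) p₀.proj).symm z.1 ∈ (extChartAt 𝓘(ℝ, E) p.proj).source := by
    rw [← hp]
    exact mem_extChartAt_source p.proj
  have hL := isInvertible_tangentCoordChange ((extChartAt 𝓘(ℝ, E) p₀.proj).map_target hy) hx
  rw [← (hasFDerivAt_transition hy hx).fderiv] at hL
  let e := trivializationAt (E × (E →L[ℝ] ℝ)) (TangentSpace (cotangentModel E)) p₀
  let S : E × (E →L[ℝ] ℝ) →L[ℝ] E × (E →L[ℝ] ℝ) := e.symmL ℝ p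
  refine ContinuousLinearMap.ext fun X ↦ ?_
  have h1 : (cruceanuJ g p (S X) : E × (E →L[ℝ] ℝ))
      = S (modelJ (bilinInChart 𝓘(ℝ, E) g.inner p₀.proj) z X) := by
    refine (cruceanuJ_eq_modelJ g p (S X)).trans ((congrArg (fun c ↦
      modelJ (bilinInChart 𝓘(ℝ, E) g.inner p.proj) c (S X)) hc).trans ?_)
    exact modelJ_transition (christoffel_transition g hy hx) hL hS X
  have h2 := e.continuousLinearMapAt_symmL (R := ℝ) (extChartAt_symm_mem_baseSet hz)
    (modelJ (bilinInChart 𝓘(ℝ, E) g.inner p₀.proj) z X)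
  exact (congrArg (fun W ↦ e.continuousLinearMapAt ℝ p W) h1).trans h2

/-- The counterpart for the metric; here f is also read in both charts, at the same point of M. -/
theorem bilinInChart_cheegerGromollMetric [FiniteDimensional ℝ E]
    (g : Bundle.ContMDiffRiemannianMetric 𝓘(ℝ, E) ∞ E (fun x : M ↦ TangentSpace 𝓘(ℝ, E) x))
    (f : M → ℝ) (p₀ : CotangentBundle E M) {z : E × (E →L[ℝ] ℝ)}
    (hz : z ∈ (extChartAt (cotangentModel E) p₀).target) :
    bilinInChart (cotangentModel E) (cheegerGromollMetric g f) p₀ z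
      = modelMetric (bilinInChart 𝓘(ℝ, E) g.inner p₀.proj)
        (fun y ↦ f ((extChartAt 𝓘(ℝ, E) p₀.proj).symm y)) z := by
  obtain ⟨hS, hc⟩ := symmL_cotangent hz
  have hy : z.1 ∈ (extChartAt 𝓘(ℝ, E) p₀.proj).target := by
    rw [extChartAt_cotangent_target] at hz
    exact hz.1
  have hp := extChartAt_cotangent_symm_proj hz
  set p := (extChartAt (cotangentModel E) p₀).symm z with hpdef
  have hx : (extChartAt 𝓘(ℝ, E) p₀.proj).symm z.1 ∈ (extChartAt 𝓘(ℝ, E) p.proj).source := by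
    rw [← hp]
    exact mem_extChartAt_source p.proj
  have hL := isInvertible_tangentCoordChange ((extChartAt 𝓘(ℝ, E) p₀.proj).map_target hy) hx
  rw [← (hasFDerivAt_transition hy hx).fderiv] at hL
  let e := trivializationAt (E × (E →L[ℝ] ℝ)) (TangentSpace (cotangentModel E)) p₀
  let S : E × (E →L[ℝ] ℝ) →L[ℝ] E × (E →L[ℝ] ℝ) := e.symmL ℝ p
  refine ContinuousLinearMap.ext fun X ↦ ContinuousLinearMap.ext fun Y ↦ ?_
  refine (cheegerGromollMetric_eq_modelMetric g f p (S X) (S Y)).trans ((congrArg (fun c ↦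
    modelMetric (bilinInChart 𝓘(ℝ, E) g.inner p.proj)
      (fun y ↦ f ((extChartAt 𝓘(ℝ, E) p.proj).symm y)) c (S X) (S Y)) hc).trans ?_)
  refine modelMetric_transition ?_ (bilinInChart_transition g.inner hy hx)
    (bilinInChart_isInvertible g ((extChartAt 𝓘(ℝ, E) p.proj).map_source hx))
    (bilinInChart_isInvertible g hy) (christoffel_transition g hy hx) hL hS X Y
  rw [Function.comp_apply, (extChartAt 𝓘(ℝ, E) p.proj).left_inv hx]

end Cotangent

/-! ### The three equivalences -/

section Main

variable {E : Type*} [NormedAddCommGroup E] [NormedSpace ℝ E] [FiniteDimensional ℝ E]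
  {M : Type*} [TopologicalSpace M] [ChartedSpace E M] [IsManifold 𝓘(ℝ, E) ∞ M]
  (g : Bundle.ContMDiffRiemannianMetric 𝓘(ℝ, E) ∞ E (fun x : M ↦ TangentSpace 𝓘(ℝ, E) x))
  {f : M → ℝ}

theorem endoInChart_cruceanuJ_eventuallyEq (p : CotangentBundle E M) :
    endoInChart (cotangentModel E) (cruceanuJ g) p
      =ᶠ[𝓝 (extChartAt (cotangentModel E) p p)]
        modelJ (bilinInChart 𝓘(ℝ, E) g.inner p.proj) :=
  (eventually_mem_extChartAt_target p).mono fun _ hz ↦ endoInChart_cruceanuJ g p hz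

theorem bilinInChart_cheegerGromollMetric_eventuallyEq (f : M → ℝ) (p : CotangentBundle E M) :
    bilinInChart (cotangentModel E) (cheegerGromollMetric g f) p
      =ᶠ[𝓝 (extChartAt (cotangentModel E) p p)]
        modelMetric (bilinInChart 𝓘(ℝ, E) g.inner p.proj)
          (fun y ↦ f ((extChartAt 𝓘(ℝ, E) p.proj).symm y)) :=
  (eventually_mem_extChartAt_target p).mono fun _ hz ↦ bilinInChart_cheegerGromollMetric g f p hz

omit [FiniteDimensional ℝ E] in
theorem extChartAt_cotangent_self_fst_mem (p : CotangentBundle E M) :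
    (extChartAt (cotangentModel E) p p).1 ∈ (extChartAt 𝓘(ℝ, E) p.proj).target := by
  have h := mem_extChartAt_target (I := cotangentModel E) p
  rw [extChartAt_cotangent_target] at h
  exact h.1

theorem contDiffAt_endoInChart_cruceanuJ (p : CotangentBundle E M) :
    ContDiffAt ℝ ∞ (endoInChart (cotangentModel E) (cruceanuJ g) p)
      (extChartAt (cotangentModel E) p p) := by
  have := FiniteDimensional.complete ℝ E
  have h := extChartAt_cotangent_self_fst_mem p
  exact (contDiffAt_modelJ (contDiffAt_bilinInChart g.contMDiff h)
    (bilinInChart_isInvertible g h)).congr_of_eventuallyEq (endoInChart_cruceanuJ_eventuallyEq g p)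

theorem contDiffAt_bilinInChart_cheegerGromollMetric (hf : ContMDiff 𝓘(ℝ, E) 𝓘(ℝ, ℝ) ∞ f)
    (p : CotangentBundle E M) :
    ContDiffAt ℝ ∞ (bilinInChart (cotangentModel E) (cheegerGromollMetric g f) p)
      (extChartAt (cotangentModel E) p p) := by
  have h := extChartAt_cotangent_self_fst_mem p
  exact (contDiffAt_modelMetric (contDiffAt_bilinInChart g.contMDiff h)
    (bilinInChart_isInvertible g h) (bilinInChart_pos g h)
    (contDiffAt_of_contMDiffAt_chart h (hf _))).congr_of_eventuallyEq
      (bilinInChart_cheegerGromollMetric_eventuallyEq g f p)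

theorem tachibana_congr {V : Type*} [NormedAddCommGroup V] [NormedSpace ℝ V]
    {A A' : V → V →L[ℝ] V} {G G' : V → V →L[ℝ] V →L[ℝ] ℝ} {y : V} (hA : A =ᶠ[𝓝 y] A')
    (hG : G =ᶠ[𝓝 y] G') (X Y Z : V) : tachibana A G y X Y Z = tachibana A' G' y X Y Z := by
  unfold tachibana
  rw [hA.fderiv_eq, hG.fderiv_eq, hA.self_of_nhds, hG.self_of_nhds]

omit [FiniteDimensional ℝ E] in
theorem riemannCurvature_eq_flatCurvature (x : M) (u v w : E) :
    riemannCurvature 𝓘(ℝ, E) g.inner x u v w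
      = flatCurvature (bilinInChart 𝓘(ℝ, E) g.inner x) (extChartAt 𝓘(ℝ, E) x x) u v w := rfl

/-- The Tachibana operator of the cotangent bundle, expressed through the curvature of the base. -/
theorem tachibana_cotangent (hf : ContMDiff 𝓘(ℝ, E) 𝓘(ℝ, ℝ) ∞ f) (p : CotangentBundle E M)
    (X Y Z : E × (E →L[ℝ] ℝ)) :
    let B := bilinInChart 𝓘(ℝ, E) g.inner p.proj
    let z : E × (E →L[ℝ] ℝ) := (extChartAt 𝓘(ℝ, E) p.proj p.proj, p.snd)
    tachibana (endoInChart (cotangentModel E) (cruceanuJ g) p)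
      (bilinInChart (cotangentModel E) (cheegerGromollMetric g f) p)
      (extChartAt (cotangentModel E) p p) X Y Z
      = 2 * modelFiberMetric B z (z.2.comp (flatCurvature B z.1 X.1 Y.1)) (modelVertical B z Z)
        + 2 * modelFiberMetric B z (modelVertical B z Y)
          (z.2.comp (flatCurvature B z.1 X.1 Z.1)) := by
  intro B z
  have h := extChartAt_cotangent_self_fst_mem p
  rw [tachibana_congr (endoInChart_cruceanuJ_eventuallyEq g p)
    (bilinInChart_cheegerGromollMetric_eventuallyEq g f p)]
  have hz : extChartAt (cotangentModel E) p p = z := extChartAt_cotangent_self p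
  have hev : ∀ᶠ y in 𝓝 (extChartAt (cotangentModel E) p p).1,
    y ∈ (extChartAt 𝓘(ℝ, E) p.proj).target := (isOpen_extChartAt_target p.proj).mem_nhds h
  refine (tachibana_model (contDiffAt_bilinInChart g.contMDiff h)
    (contDiffAt_of_contMDiffAt_chart h (hf _)) (bilinInChart_isInvertible g h)
    (bilinInChart_pos g h) (.of_forall fun y ↦ bilinInChart_symm g p.proj y)
    (hev.mono fun y hy ↦ bilinInChart_isInvertible g hy) X Y Z).trans ?_
  rw [hz]

theorem tachibana_cotangent_eq_zero_iff (hf : ContMDiff 𝓘(ℝ, E) 𝓘(ℝ, ℝ) ∞ f) :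
    (∀ (p : CotangentBundle E M) (X Y Z : E × (E →L[ℝ] ℝ)),
      tachibana (endoInChart (cotangentModel E) (cruceanuJ g) p)
        (bilinInChart (cotangentModel E) (cheegerGromollMetric g f) p)
        (extChartAt (cotangentModel E) p p) X Y Z = 0) ↔ IsFlatMetric 𝓘(ℝ, E) g.inner := by
  constructor
  · intro h x u v w
    have hx := mem_extChartAt_target (I := 𝓘(ℝ, E)) x
    refine (riemannCurvature_eq_flatCurvature g x u v w).trans ?_
    by_contra hne
    -- By Hahn-Banach, some covector ξ takes the value ‖R(u, v)w‖ at R(u, v)w; the test takes place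
    -- at the point ξ of T*M.
    obtain ⟨ξ, hξ⟩ := exists_dual_vector'' ℝ
      (flatCurvature (bilinInChart 𝓘(ℝ, E) g.inner x) (extChartAt 𝓘(ℝ, E) x x) u v w)
    set B := bilinInChart 𝓘(ℝ, E) g.inner x
    set y := extChartAt 𝓘(ℝ, E) x x
    let η : E →L[ℝ] ℝ := ξ.comp (flatCurvature B y u v)
    have hη : η ≠ 0 := by
      intro h0
      have h1 : ξ (flatCurvature B y u v w) = 0 := DFunLike.congr_fun h0 w
      rw [hξ.2] at h1
      simp at h1
      exact hne h1
    -- The second argument is the horizontal lift of v, which kills the term containing V Y. The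
    -- third is the vertical lift of η, which turns the other term into 2 h(η, η). Only the base
    -- component of the first argument matters.
    have h1 := h ⟨x, ξ⟩ (u, 0) (v, ξ.comp (flatChristoffel B y v)) (0, η)
    have h2 := tachibana_cotangent g hf ⟨x, ξ⟩ (u, 0) (v, ξ.comp (flatChristoffel B y v)) (0, η)
    have h3 : modelVertical B (y, ξ) (v, ξ.comp (flatChristoffel B y v)) = 0 := by
      rw [modelVertical_apply]
      exact sub_self _
    have h4 : modelVertical B (y, ξ) (0, η) = η := by
      rw [modelVertical_apply]
      simp
    have h5 := h1.symm.trans h2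
    have h6 : (0 : ℝ) = 2 * modelFiberMetric B (y, ξ) η (modelVertical B (y, ξ) (0, η))
        + 2 * modelFiberMetric B (y, ξ)
          (modelVertical B (y, ξ) (v, ξ.comp (flatChristoffel B y v)))
          (ξ.comp (flatCurvature B y u 0)) := h5
    rw [h3, h4, map_zero, zero_apply] at h6
    have h7 := modelFiberMetric_self_pos (z := (y, ξ)) (bilinInChart_isInvertible g hx)
      (bilinInChart_pos g hx) hη
    linarith
  · intro h p X Y Z
    have h1 : ∀ u v, flatCurvature (bilinInChart 𝓘(ℝ, E) g.inner p.proj)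
        (extChartAt 𝓘(ℝ, E) p.proj p.proj) u v = 0 := by
      intro u v
      ext w
      exact h p.proj u v w
    have h2 (ξ : E →L[ℝ] ℝ) (a b : E →L[ℝ] ℝ)
        (Q : (E →L[ℝ] ℝ) →L[ℝ] (E →L[ℝ] ℝ) →L[ℝ] ℝ) (R S : E →L[ℝ] E) (hR : R = 0) (hS : S = 0) :
        2 * Q (ξ.comp R) a + 2 * Q b (ξ.comp S) = 0 := by
      simp [hR, hS]
    exact (tachibana_cotangent g hf p X Y Z).trans (h2 _ _ _ _ _ _ (h1 _ _) (h1 _ _))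

/-- No curvature enters here: these properties are pointwise algebra plus smoothness of the model
formulas. -/
theorem isAlmostProductRiemannian_cotangent [Nontrivial E] [Nonempty M]
    (hf : ContMDiff 𝓘(ℝ, E) 𝓘(ℝ, ℝ) ∞ f) (hf_pos : ∀ x : M, 0 < f x) :
    IsAlmostProductRiemannian (cotangentModel E) (cheegerGromollMetric g f) (cruceanuJ g) := by
  have hpos : ∀ (p : CotangentBundle E M) (v : E × (E →L[ℝ] ℝ)), v ≠ 0 →
      0 < cheegerGromollMetric g f p v v := by
    intro p v hv
    have h := mem_extChartAt_target (I := 𝓘(ℝ, E)) p.proj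
    rw [cheegerGromollMetric_eq_modelMetric]
    exact modelMetric_self_pos (bilinInChart_isInvertible g h) (bilinInChart_pos g h)
      (hf_pos _) hv
  refine ⟨⟨⟨cheegerGromollMetric g f, ?_, hpos, ?_, ?_⟩, fun _ ↦ rfl⟩, ?_, ?_, ?_, ?_, ?_⟩
  · intro p v w
    have h := mem_extChartAt_target (I := 𝓘(ℝ, E)) p.proj
    exact (cheegerGromollMetric_eq_modelMetric g f p v w).trans
      ((modelMetric_symm (bilinInChart_isInvertible g h) (bilinInChart_symm g p.proj _) v w).trans
        (cheegerGromollMetric_eq_modelMetric g f p w v).symm)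
  · intro p
    exact isVonNBounded_of_pos (hpos p)
  · exact contMDiff_bilin_of_contDiffAt (contDiffAt_bilinInChart_cheegerGromollMetric g hf)
  · exact contMDiff_endo_of_contDiffAt (contDiffAt_endoInChart_cruceanuJ g)
  · intro p u
    exact modelJ_modelJ (B := bilinInChart 𝓘(ℝ, E) g.inner p.proj)
      (extChartAt 𝓘(ℝ, E) p.proj p.proj, p.snd) u
  · obtain ⟨x⟩ := ‹Nonempty M›
    obtain ⟨u, hu⟩ := exists_ne (0 : E)
    have h2 (a : E) (ha : a = -a) : a = 0 := by
      have h3 : (2 : ℝ) • a = 0 := (two_smul ℝ a).trans (add_eq_zero_iff_eq_neg.2 ha)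
      exact (smul_eq_zero.1 h3).resolve_left two_ne_zero
    -- J negates a nonzero horizontal lift, so it is not the identity; the zero covector is just a
    -- convenient base point.
    refine ⟨⟨x, 0⟩, horizontalLift g ⟨x, 0⟩ u, fun h ↦ hu ?_⟩
    have h1 : -u = u := congrArg (horizontalPart (E := E) (M := M) ⟨x, 0⟩)
      ((cruceanuJ_horizontalLift g ⟨x, 0⟩ u).symm.trans h)
    exact h2 u h1.symm
  · obtain ⟨x⟩ := ‹Nonempty M›
    obtain ⟨η, hη⟩ := exists_ne (0 : E →L[ℝ] ℝ)
    have h2 (a : E →L[ℝ] ℝ) (ha : a = -a) : a = 0 := by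
      have h3 : (2 : ℝ) • a = 0 := (two_smul ℝ a).trans (add_eq_zero_iff_eq_neg.2 ha)
      exact (smul_eq_zero.1 h3).resolve_left two_ne_zero
    -- J fixes a nonzero vertical lift, so it is not minus the identity.
    refine ⟨⟨x, 0⟩, verticalLift ⟨x, 0⟩ η, fun h ↦ hη ?_⟩
    have h1 : η = -η := congrArg (Prod.snd : E × (E →L[ℝ] ℝ) → _)
      ((cruceanuJ_verticalLift g ⟨x, 0⟩ η).symm.trans h)
    exact h2 η h1
  · intro p u v
    exact (cheegerGromollMetric_eq_modelMetric g f p _ v).trans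
      ((modelMetric_pure _ u v).trans (cheegerGromollMetric_eq_modelMetric g f p u _).symm)

theorem isParallelEndo_cotangent_iff (hf : ContMDiff 𝓘(ℝ, E) 𝓘(ℝ, ℝ) ∞ f)
    (hf_pos : ∀ x : M, 0 < f x) :
    IsParallelEndo (cotangentModel E) (cheegerGromollMetric g f) (cruceanuJ g) ↔
      IsFlatMetric 𝓘(ℝ, E) g.inner := by
  rw [← tachibana_cotangent_eq_zero_iff g hf]
  -- Both conditions are pointwise on T*M, and the general equivalence applies in the chart around
  -- each p.
  refine forall_congr' fun p ↦ ?_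
  have h := extChartAt_cotangent_self_fst_mem p
  have hA := endoInChart_cruceanuJ_eventuallyEq g p
  have hG := bilinInChart_cheegerGromollMetric_eventuallyEq g f p
  have hev : ∀ᶠ z : E × (E →L[ℝ] ℝ) in 𝓝 (extChartAt (cotangentModel E) p p),
      z.1 ∈ (extChartAt 𝓘(ℝ, E) p.proj).target :=
    continuousAt_fst.eventually ((isOpen_extChartAt_target p.proj).mem_nhds h)
  refine parallel_iff_tachibana (E := E × (E →L[ℝ] ℝ))
    (A := endoInChart (cotangentModel E) (cruceanuJ g) p)
    (G := bilinInChart (cotangentModel E) (cheegerGromollMetric g f) p)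
    (y := extChartAt (cotangentModel E) p p)
    ((contDiffAt_endoInChart_cruceanuJ g p).differentiableAt (by simp))
    ((contDiffAt_bilinInChart_cheegerGromollMetric g hf p).differentiableAt (by simp)) ?_ ?_ ?_
  · rw [hG.self_of_nhds]
    exact isInvertible_of_pos fun v hv ↦ modelMetric_self_pos (bilinInChart_isInvertible g h)
      (bilinInChart_pos g h) (hf_pos _) hv
  · filter_upwards [hG, hev] with z hz hz'
    rw [hz]
    exact modelMetric_symm (bilinInChart_isInvertible g hz') (bilinInChart_symm g p.proj _)
  · filter_upwards [hG, hA] with z hz hz'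
    rw [hz, hz']
    exact modelMetric_pure z

theorem phiVanishes_cotangent_iff [T2Space M] (hf : ContMDiff 𝓘(ℝ, E) 𝓘(ℝ, ℝ) ∞ f) :
    PhiVanishes (cotangentModel E) (cruceanuJ g) (cheegerGromollMetric g f) ↔
      IsFlatMetric 𝓘(ℝ, E) g.inner := by
  rw [← tachibana_cotangent_eq_zero_iff g hf]
  have := FiniteDimensional.complete ℝ E
  have : T2Space (CotangentBundle E M) := Bundle.TotalSpace.t2Space
  have key := fun (p : CotangentBundle E M)
      (X Y Z : ∀ q : CotangentBundle E M, TangentSpace (cotangentModel E) q) ↦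
    phiOperator_eq_tachibana (X := X) (Y := Y) (Z := Z)
    ((contDiffAt_endoInChart_cruceanuJ g p).differentiableAt (by simp))
    ((contDiffAt_bilinInChart_cheegerGromollMetric g hf p).differentiableAt (by simp))
    (fun v w ↦ (cheegerGromollMetric_eq_modelMetric g f p _ w).trans
      ((modelMetric_pure _ v w).trans (cheegerGromollMetric_eq_modelMetric g f p v _).symm))
  constructor
  · intro h p X Y Z
    -- Arbitrary tangent vectors at p are realized by global smooth fields, to which the hypothesis
    -- applies.
    obtain ⟨X', hX, rfl⟩ := exists_contMDiff_vectorField (I := cotangentModel E) p X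
    obtain ⟨Y', hY, rfl⟩ := exists_contMDiff_vectorField (I := cotangentModel E) p Y
    obtain ⟨Z', hZ, rfl⟩ := exists_contMDiff_vectorField (I := cotangentModel E) p Z
    exact (key p X' Y' Z' hX hY hZ).symm.trans (h X' Y' Z' hX hY hZ p)
  · intro h X Y Z hX hY hZ p
    exact (key p X Y Z hX hY hZ).trans (h p _ _ _)

end Main
end

theorem mainTheorem7
    {E : Type*} [NormedAddCommGroup E] [NormedSpace ℝ E] [FiniteDimensional ℝ E] [Nontrivial E]
    {M : Type*} [TopologicalSpace M] [T2Space M] [Nonempty M] [ChartedSpace E M]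
    [IsManifold 𝓘(ℝ, E) ∞ M]
    (g : Bundle.ContMDiffRiemannianMetric 𝓘(ℝ, E) ∞ E (fun x : M ↦ TangentSpace 𝓘(ℝ, E) x))
    (f : M → ℝ) (hf : ContMDiff 𝓘(ℝ, E) 𝓘(ℝ, ℝ) ∞ f) (hf_pos : ∀ x : M, 0 < f x) :
    (IsLocallyDecomposable (cotangentModel E) (cheegerGromollMetric g f) (cruceanuJ g) ↔
      IsFlatMetric 𝓘(ℝ, E) g.inner) ∧
    (IsParallelEndo (cotangentModel E) (cheegerGromollMetric g f) (cruceanuJ g) ↔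
      IsFlatMetric 𝓘(ℝ, E) g.inner) ∧
    (PhiVanishes (cotangentModel E) (cruceanuJ g) (cheegerGromollMetric g f) ↔
      IsFlatMetric 𝓘(ℝ, E) g.inner) := by
  have h := isParallelEndo_cotangent_iff g hf hf_pos
  -- The almost product axioms always hold, so the first condition reduces to the second.
  exact ⟨⟨fun hd ↦ h.1 hd.parallel, fun hflat ↦
    ⟨isAlmostProductRiemannian_cotangent g hf hf_pos, h.2 hflat⟩⟩, h, phiVanishes_cotangent_iff g hf⟩
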